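/- Let $k$ be a separably closed field. Let $\mathrm{Grp}_f$ be the category of finite groups, $\mathrm{StoneGrp}$ the category of Stone (profinite) groups and continuous homomorphisms, $\mathrm{Chopf}_k$ the category of commutative Hopf $k$-algebras, and $\mathrm{Chopf}_{k,fg}\subseteq \mathrm{Chopf}_k$ the full subcategory of those that are finitely generated as $k$-algebras. Call a commutative $k$-algebra $A$ separable if it is finite-dimensional over $k$ and $A\otimes_k k'$ has zero Jacobson radical for every field extension $k'$ of $k$. For a finite group $G$, let $k^G$ be the algebra of functions $G\to k$, with $k^G\otimes_k k^G$ identified with $k^{G\times G}$, and with the Hopf structure $\delta(\varphi)(g,h)=\varphi(gh)$, $\varepsilon(\varphi)=\varphi(1)$, $i(\varphi)(g)=\varphi(g^{-1})$; precomposition makes this a functor $k^{(-)}\colon \mathrm{Grp}_f^{op}\to \mathrm{Chopf}_{k,fg}$. (1) Every finitely generated commutative $k$-algebra $A$ has a largest separable subalgebra $\pi_0(A)$. For $H\in\mathrm{Chopf}_{k,fg}$ the subalgebra $\pi_0(H)$ is a Hopf subalgebra of $H$, the set $\pi_0(H)_k:=\mathrm{CAlg}_k(\pi_0(H),k)$ of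 $k$-algebra homomorphisms is a finite group under convolution, and $H\mapsto \pi_0(H)_k$ is a functor $\pi_0(-)_k\colon \mathrm{Chopf}_{k,fg}\to \mathrm{Grp}_f^{op}$. (2) The functor $k^{(-)}\colon \mathrm{Grp}_f^{op}\to\mathrm{Chopf}_{k,fg}$ is fully faithful. (3) There is an adjunction $k^{(-)}\dashv \pi_0(-)_k$, and it extends to an adjunction $\mathrm{Ind}\,k^{(-)}\dashv \mathrm{Ind}\,\pi_0(-)_k$ between $\mathrm{Ind}(\mathrm{Grp}_f^{op})$ and $\mathrm{Ind}(\mathrm{Chopf}_{k,fg})$ whose unit restricts to the unit of the first one on $\mathrm{Grp}_f^{op}$. (Here $\mathrm{Ind}\,F\colon\mathrm{Ind}\,\mathcal C\to\mathrm{Ind}\,\mathcal D$ is the extension of a functor $F\colon\mathcal C\to\mathcal D$ to Ind-objects, i.e. the left Kan extension of $\mathcal C\to\mathcal D\to\mathrm{Ind}\,\mathcal D$ along $\mathcal C\to\mathrm{Ind}\,\mathcal C$.) (4) The inclusions $\mathrm{Grp}_f^{op}\to\mathrm{StoneGrp}^{op}$ and $\mathrm{Chopf}_{k,fg}\to\mathrm{Chopf}_k$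 exhibit their targets as Ind-completions of their sources, i.e. they extend to equivalences $\mathrm{Ind}(\mathrm{Grp}_f^{op})\simeq\mathrm{StoneGrp}^{op}$ and $\mathrm{Ind}(\mathrm{Chopf}_{k,fg})\simeq\mathrm{Chopf}_k$. Under any such equivalences, the functor $\mathrm{Ind}\,k^{(-)}\colon\mathrm{StoneGrp}^{op}\to\mathrm{Chopf}_k$ is fully faithful and left adjoint to $\mathrm{Ind}\,\pi_0(-)_k\colon\mathrm{Chopf}_k\to\mathrm{StoneGrp}^{op}$. -/

import Mathlib

open CategoryTheory CategoryTheory.Limits TensorProduct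

universe u v w

namespace HopfPi0

section IndCompletion
variable {C : Type w} [Category.{v} C] {D : Type w} [Category.{v} D]

/-- The colimits that compute `Ind F` exist: they are indexed by filtered categories with a small
cofinal diagram. -/
instance indMap_hasPointwise (F : C ⥤ D) :
    (Ind.yoneda (C := C)).HasPointwiseLeftKanExtension (F ⋙ Ind.yoneda) := fun X => by
  let e : CostructuredArrow (Ind.yoneda (C := C)) X ≌
      CostructuredArrow (yoneda (C := C)) ((Ind.inclusion C).obj X) :=
    (CostructuredArrow.post Ind.yoneda (Ind.inclusion C) X).asEquivalence.trans
      (CostructuredArrow.mapNatIso Ind.yonedaCompInclusion)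
  have h := Ind.isIndObject_inclusion_obj X
  let P := h.presentation
  have := P.hI
  have : (P.toCostructuredArrow ⋙ e.inverse).Final := inferInstance
  exact Functor.Final.hasColimit_of_comp (P.toCostructuredArrow ⋙ e.inverse)

/-- The Ind-extension `Ind F : Ind C ⥤ Ind D` of a functor `F : C ⥤ D`: the (pointwise) left Kan
extension of `C ⥤ D ⥤ Ind D` along `C ⥤ Ind C`. Its value at a formal filtered colimit of objects
`X i` is the formal filtered colimit of the objects `F (X i)`. -/
noncomputable def indMap (F : C ⥤ D) : Ind C ⥤ Ind D :=
  Ind.yoneda.leftKanExtension (F ⋙ Ind.yoneda)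

/-- The canonical comparison (an isomorphism) between `F` and the restriction of `Ind F` to `C`. -/
noncomputable def indMapUnit (F : C ⥤ D) : F ⋙ Ind.yoneda ⟶ Ind.yoneda ⋙ indMap F :=
  Ind.yoneda.leftKanExtensionUnit (F ⋙ Ind.yoneda)

/-- A presentation of `D'` as the Ind-completion of `C'`, along the functor `ι : C' ⥤ D'`: an
equivalence `Ind C' ≌ D'` that restricts to `ι` on `C'`. -/
structure IndPresentation {C' : Type w} [Category.{v} C'] {D' : Type w} [Category.{v} D']
    (ι : C' ⥤ D') where
  /-- The equivalence. -/
  equiv : Ind C' ≌ D'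
  /-- Its restriction to `C'` is `ι`. -/
  iso : Ind.yoneda ⋙ equiv.functor ≅ ι

/-- The Ind-extension of `F : C ⥤ D`, read as a functor between given Ind-completions `C'` of `C`
and `D'` of `D`. -/
noncomputable def indExtend {C' D' : Type w} [Category.{v} C'] [Category.{v} D']
    {ι : C ⥤ C'} {κ : D ⥤ D'} (P : IndPresentation ι) (Q : IndPresentation κ) (F : C ⥤ D) :
    C' ⥤ D' :=
  P.equiv.inverse ⋙ indMap F ⋙ Q.equiv.functor

end IndCompletion

section Sep
variable (k : Type u) [Field k] (A : Type u) [CommRing A] [Algebra k A]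
/-- `A` is classically separable over `k`: for every field extension `K` of `k`, the Jacobson radical
of `A ⊗ K` is zero. -/
def IsClassicallySeparable : Prop :=
  ∀ (K : Type u) [Field K] [Algebra k K], Ring.jacobson (A ⊗[k] K) = ⊥

/-- Finite separable `k`-algebras: finite-dimensional and classically separable. -/
def IsFiniteSeparable : Prop := Module.Finite k A ∧ IsClassicallySeparable k A

/-- `π₀(A)`: the supremum of all finite separable `k`-subalgebras of `A`. (For `A` finitely generated
it is the largest one.) -/
def pi0 : Subalgebra k A := sSup {B : Subalgebra k A | IsFiniteSeparable k B}

end Sep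
section I
variable {k : Type u} [Field k] {A : Type u} [CommRing A] [Algebra k A]

theorem IsFiniteSeparable.of_surjective {B : Type u} [CommRing B] [Algebra k B] (f : A →ₐ[k] B)
    (hf : Function.Surjective f) (h : IsFiniteSeparable k A) : IsFiniteSeparable k B := by
  obtain ⟨h1, h2⟩ := h
  have h3 : Module.Finite k B := Module.Finite.of_surjective f.toLinearMap hf
  refine ⟨h3, fun K _ _ => ?_⟩
  have h4 := h2 K
  have : IsArtinianRing (K ⊗[k] A) := IsArtinianRing.of_finite K _
  have : IsArtinianRing (A ⊗[k] K) :=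
    (Algebra.TensorProduct.comm k K A).toRingEquiv.surjective.isArtinianRing
  have : IsSemisimpleRing (A ⊗[k] K) := IsArtinianRing.isSemisimpleRing_iff_jacobson.2 h4
  have : IsSemisimpleRing (B ⊗[k] K) :=
    RingHom.isSemisimpleRing_of_surjective
      (Algebra.TensorProduct.map f (AlgHom.id k K)).toRingHom
      (TensorProduct.map_surjective hf Function.surjective_id)
  exact IsSemisimpleRing.jacobson_eq_bot _

theorem isFiniteSeparable_fun (ι : Type u) [Finite ι] : IsFiniteSeparable k (ι → k) := by
  classical
  cases nonempty_fintype ι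
  refine ⟨inferInstance, fun K _ _ => ?_⟩
  have : IsSemisimpleRing ((ι → k) ⊗[k] K) :=
    RingHom.isSemisimpleRing_of_surjective (R := ι → K)
      ((Algebra.TensorProduct.comm k (ι → k) K).trans
        (Algebra.TensorProduct.piScalarRight k k K ι)).symm.toRingEquiv.toRingHom
      (AlgEquiv.surjective _)
  exact IsSemisimpleRing.jacobson_eq_bot _

theorem mem_pi0_of_isIdempotentElem {e : A} (he : IsIdempotentElem e) : e ∈ pi0 k A := by
  let f : (ULift.{u} Bool → k) →ₐ[k] A := AlgHom.ofLinearMap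
    ((LinearMap.proj (ULift.up true)).smulRight e + (LinearMap.proj (ULift.up false)).smulRight (1 - e))
    (by simp) (fun x y => by
      have h1 : e * e = e := he
      simp only [LinearMap.add_apply, LinearMap.smulRight_apply, LinearMap.proj_apply, Pi.mul_apply,
        Algebra.smul_def, map_mul]
      linear_combination (-(algebraMap k A (x ⟨true⟩) * algebraMap k A (y ⟨true⟩)
        + algebraMap k A (x ⟨false⟩) * algebraMap k A (y ⟨false⟩)) +
        algebraMap k A (x ⟨true⟩) * algebraMap k A (y ⟨false⟩)
        + algebraMap k A (x ⟨false⟩) * algebraMap k A (y ⟨true⟩)) * h1)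
  have h : f.range ≤ pi0 k A := le_sSup <|
    (isFiniteSeparable_fun (k := k) (ULift.{u} Bool)).of_surjective f.rangeRestrict
      f.rangeRestrict_surjective
  refine h ⟨fun i => if i.down then 1 else 0, ?_⟩
  simp [f]



theorem eq_sum_of_tmul_one_eq (K : Type u) [Field K] [Algebra k K] {ι : Type u} [Fintype ι]
    (b : A) (e : ι → A) (d : ι → K) (h : b ⊗ₜ[k] (1 : K) = ∑ i, e i ⊗ₜ[k] d i) :
    ∃ r : ι → k, b = ∑ i, r i • e i := by
  obtain ⟨r, hr⟩ := LinearMap.exists_leftInverse_of_injective (Algebra.linearMap k K)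
    (LinearMap.ker_eq_bot.2 (algebraMap k K).injective)
  have hr1 : r 1 = 1 := by simpa using LinearMap.congr_fun hr 1
  refine ⟨fun i => r (d i), ?_⟩
  have h3 := congrArg (fun t => TensorProduct.rid k A (LinearMap.lTensor A r t)) h
  simpa [hr1] using h3

theorem mem_adjoin_aux (K : Type u) [Field K] [Algebra k K] [IsAlgClosed K]
    {ι : Type u} [Fintype ι] (q N : ℕ) [ExpChar k q] [Nontrivial A] [IsReduced (A ⊗[k] K)]
    (b : A) (c : ι → k) (e : ι → A) (he : ∀ i, IsIdempotentElem (e i))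
    (hb : b ^ q ^ N = ∑ i, c i • e i) :
    b ∈ Algebra.adjoin k {e : A | IsIdempotentElem e} := by
  have : ExpChar (A ⊗[k] K) q := expChar_of_injective_algebraMap (algebraMap k _).injective q
  have hq0 : 0 < q ^ N := pow_pos (expChar_pos k q) N
  choose d hd using fun m => IsAlgClosed.exists_pow_nat_eq (algebraMap k K (c m)) hq0
  have hx : b ⊗ₜ[k] (1 : K) - ∑ m, e m ⊗ₜ[k] d m = 0 := by
    have h : (b ⊗ₜ[k] (1 : K) - ∑ m, e m ⊗ₜ[k] d m) ^ q ^ N = 0 := by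
      rw [sub_pow_expChar_pow, sum_pow_char_pow, Algebra.TensorProduct.tmul_pow, one_pow, hb,
        sub_eq_zero, sum_tmul]
      refine Finset.sum_congr rfl fun m _ => ?_
      rw [Algebra.TensorProduct.tmul_pow, hd, (he m).pow_eq hq0.ne', smul_tmul, Algebra.smul_def,
        mul_one]
    exact eq_zero_of_pow_eq_zero h
  obtain ⟨r, hr⟩ := eq_sum_of_tmul_one_eq K b e d (sub_eq_zero.1 hx)
  have h4 : ∀ m, e m ∈ Algebra.adjoin k {e : A | IsIdempotentElem e} :=
    fun m => Algebra.subset_adjoin (he m)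
  have h5 : ∑ i, r i • e i ∈ Algebra.adjoin k {e : A | IsIdempotentElem e} :=
    Subalgebra.sum_mem _ fun m _ => Subalgebra.smul_mem _ (h4 m) _
  exact hr ▸ h5

theorem exists_pow_eq_sum [IsSepClosed k] [Module.Finite k A] [IsReduced A] (q : ℕ) [ExpChar k q]
    (b : A) : ∃ (ι : Type u) (_ : Fintype ι) (N : ℕ) (c : ι → k) (e : ι → A),
      (∀ i, IsIdempotentElem (e i)) ∧ b ^ q ^ N = ∑ i, c i • e i := by
  classical
  have : IsArtinianRing A := IsArtinianRing.of_finite k _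
  have : Finite (MaximalSpectrum A) := inferInstance
  cases nonempty_fintype (MaximalSpectrum A)
  have key (m : MaximalSpectrum A) : ∃ n : ℕ, ∃ c : k,
      algebraMap k (A ⧸ m.asIdeal) c = (Ideal.Quotient.mk m.asIdeal b) ^ q ^ n := by
    let := Ideal.Quotient.field m.asIdeal
    have : Module.Finite k (A ⧸ m.asIdeal) := inferInstance
    have : Algebra.IsAlgebraic k (A ⧸ m.asIdeal) := inferInstance
    exact IsPurelyInseparable.pow_mem k q _
  choose n c hc using key
  have hN (m) : n m ≤ ∑ m, n m :=
    Finset.single_le_sum (fun _ _ => Nat.zero_le _) (Finset.mem_univ m)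
  generalize (∑ m, n m) = N at hN
  have hc' (m) : algebraMap k (A ⧸ m.asIdeal) (c m ^ q ^ (N - n m)) =
      (Ideal.Quotient.mk m.asIdeal b) ^ q ^ N := by
    rw [map_pow, hc, ← pow_mul, ← pow_add, Nat.add_sub_cancel' (hN m)]
  let E := IsArtinianRing.equivPi A
  refine ⟨MaximalSpectrum A, inferInstance, N, fun m => c m ^ q ^ (N - n m),
    fun m => E.symm (Pi.single m 1), fun m => ?_, ?_⟩
  · change _ * _ = _
    rw [← map_mul, ← Pi.single_mul, one_mul]
  · apply E.injective
    funext m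
    rw [map_sum, Finset.sum_apply, Finset.sum_eq_single m]
    · rw [Algebra.smul_def, map_mul, Pi.mul_apply, AlgEquiv.apply_symm_apply, Pi.single_eq_same,
        mul_one, map_pow]
      exact (hc' m).symm
    · intro m' _ hm
      rw [Algebra.smul_def, map_mul, Pi.mul_apply, AlgEquiv.apply_symm_apply,
        Pi.single_eq_of_ne hm.symm, mul_zero]
    · simp

theorem IsFiniteSeparable.mem_adjoin [IsSepClosed k] (h : IsFiniteSeparable k A) (b : A) :
    b ∈ Algebra.adjoin k {e : A | IsIdempotentElem e} := by
  obtain ⟨h1, h2⟩ := h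
  nontriviality A
  have : IsArtinianRing (AlgebraicClosure k ⊗[k] A) := IsArtinianRing.of_finite (AlgebraicClosure k) _
  have : IsArtinianRing (A ⊗[k] AlgebraicClosure k) :=
    (Algebra.TensorProduct.comm k (AlgebraicClosure k) A).toRingEquiv.surjective.isArtinianRing
  have : IsSemisimpleRing (A ⊗[k] AlgebraicClosure k) :=
    IsArtinianRing.isSemisimpleRing_iff_jacobson.2 (h2 _)
  have : IsReduced (A ⊗[k] AlgebraicClosure k) := inferInstance
  have : IsReduced A := isReduced_of_injective
    (Algebra.TensorProduct.includeLeft : A →ₐ[k] A ⊗[k] AlgebraicClosure k)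
    (Algebra.TensorProduct.includeLeft_injective (algebraMap k _).injective)
  obtain ⟨q, hq⟩ := ExpChar.exists k
  obtain ⟨ι, _, N, c, e, he, hb⟩ := exists_pow_eq_sum (k := k) q b
  exact mem_adjoin_aux (AlgebraicClosure k) q N b c e he hb

theorem pi0_eq_adjoin (k : Type u) [Field k] (A : Type u) [CommRing A] [Algebra k A]
    [IsSepClosed k] :
    pi0 k A = Algebra.adjoin k {e : A | IsIdempotentElem e} := by
  apply le_antisymm
  · refine sSup_le fun B hB b hb => ?_
    have h1 := IsFiniteSeparable.mem_adjoin hB ⟨b, hb⟩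
    have h2 : B.val ⟨b, hb⟩ ∈ (Algebra.adjoin k {e : B | IsIdempotentElem e}).map B.val :=
      ⟨_, h1, rfl⟩
    rw [AlgHom.map_adjoin] at h2
    refine Algebra.adjoin_mono ?_ h2
    rintro _ ⟨e, he, rfl⟩
    exact he.map B.val
  · exact Algebra.adjoin_le fun e he => mem_pi0_of_isIdempotentElem he

theorem map_mem_pi0 [IsSepClosed k] {B : Type u} [CommRing B] [Algebra k B] (f : A →ₐ[k] B)
    {a : A} (ha : a ∈ pi0 k A) : f a ∈ pi0 k B := by
  have h : pi0 k A ≤ (pi0 k B).comap f := by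
    rw [pi0_eq_adjoin k A]
    exact Algebra.adjoin_le fun e he => mem_pi0_of_isIdempotentElem (IsIdempotentElem.map he f)
  exact h ha

theorem finite_isIdempotentElem [IsNoetherianRing A] : {e : A | IsIdempotentElem e}.Finite := by
  have hfin := minimalPrimes.finite_of_isNoetherianRing A
  have := hfin.to_subtype
  refine Set.Finite.of_finite_image (f := fun e => {p : minimalPrimes A | e ∈ p.1})
    (Set.toFinite _) ?_
  have aux : ∀ e f : A, IsIdempotentElem e → IsIdempotentElem f →
      {p : minimalPrimes A | e ∈ p.1} = {p : minimalPrimes A | f ∈ p.1} → e * (1 - f) = 0 := by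
    intro e f he hf h
    have hn : IsIdempotentElem (e * (1 - f)) := he.mul hf.one_sub
    have : IsNilpotent (e * (1 - f)) := by
      rw [← mem_nilradical, nilradical, ← Ideal.sInf_minimalPrimes]
      refine Ideal.mem_sInf.2 fun {p} hp => ?_
      have hpp : p.IsPrime := hp.1.1
      by_cases hep : e ∈ p
      · exact p.mul_mem_right _ hep
      · have hfp : f ∉ p := fun hfp => hep <|
          (Set.ext_iff.1 h ⟨p, hp⟩).2 hfp
        refine p.mul_mem_left _ ((hpp.mem_or_mem (x := f) ?_).resolve_left hfp)
        rw [mul_sub, mul_one, hf.eq, sub_self]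
        exact p.zero_mem
    obtain ⟨n, hn'⟩ := this
    have := hn.pow_succ_eq n
    rw [pow_succ, hn', zero_mul] at this
    exact this.symm
  intro e he f hf h
  have h1 := aux e f he hf h
  have h2 := aux f e hf he h.symm
  linear_combination h1 - h2

theorem finite_pi0_algHom [IsSepClosed k] [Algebra.FiniteType k A] :
    Finite (pi0 k A →ₐ[k] k) := by
  have : IsNoetherianRing A := Algebra.FiniteType.isNoetherianRing k A
  have hfin := (finite_isIdempotentElem (A := A)).to_subtype
  rw [pi0_eq_adjoin]
  let S := {e : A | IsIdempotentElem e}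
  refine Finite.of_injective
    (fun φ : Algebra.adjoin k S →ₐ[k] k =>
      {e : S | φ ⟨e.1, Algebra.subset_adjoin e.2⟩ = 1}) fun φ ψ h => ?_
  apply AlgHom.adjoin_ext
  intro e he
  have hid (χ : Algebra.adjoin k S →ₐ[k] k) : χ ⟨e, Algebra.subset_adjoin he⟩ = 0 ∨
      χ ⟨e, Algebra.subset_adjoin he⟩ = 1 :=
    IsIdempotentElem.iff_eq_zero_or_one.1
      (IsIdempotentElem.map (show IsIdempotentElem (⟨e, Algebra.subset_adjoin he⟩ :
        Algebra.adjoin k S) from Subtype.ext he) χ)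
  have h' := Set.ext_iff.1 h ⟨e, he⟩
  simp only [Set.mem_ofPred_eq] at h'
  rcases hid φ with h1 | h1 <;> rcases hid ψ with h2 | h2 <;> simp_all

theorem exists_eq_tmul_of_isIdempotentElem [IsSepClosed k] [Nontrivial A]
    (f : AlgebraicClosure k ⊗[k] A) (hf : IsIdempotentElem f) :
    ∃ a : A, IsIdempotentElem a ∧ f = 1 ⊗ₜ a := by
  obtain ⟨q, hq⟩ := ExpChar.exists k
  have : ExpChar (AlgebraicClosure k ⊗[k] A) q :=
    expChar_of_injective_algebraMap (algebraMap k _).injective q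
  have key (t : AlgebraicClosure k ⊗[k] A) : ∃ n : ℕ, ∃ a : A, t ^ q ^ n = 1 ⊗ₜ a := by
    induction t with
    | zero => exact ⟨0, 0, by simp⟩
    | tmul x y =>
      obtain ⟨n, c, hc⟩ := IsPurelyInseparable.pow_mem k q x
      refine ⟨n, c • y ^ q ^ n, ?_⟩
      rw [Algebra.TensorProduct.tmul_pow, ← hc, ← smul_tmul, Algebra.smul_def, mul_one]
    | add s t hs ht =>
      obtain ⟨n, a, ha⟩ := hs
      obtain ⟨m, b, hb⟩ := ht
      refine ⟨n + m, a ^ q ^ m + b ^ q ^ n, ?_⟩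
      rw [add_pow_expChar_pow, pow_add, pow_mul, ha, pow_mul', hb, tmul_add,
        Algebra.TensorProduct.tmul_pow, Algebra.TensorProduct.tmul_pow, one_pow, one_pow]
  obtain ⟨n, a, ha⟩ := key f
  rw [hf.pow_eq (pow_pos (expChar_pos k q) n).ne'] at ha
  refine ⟨a, ?_, ha⟩
  apply Algebra.TensorProduct.includeRight_injective (R := k) (A := AlgebraicClosure k) (B := A)
    (algebraMap k _).injective
  simpa [ha, IsIdempotentElem] using hf


theorem exists_atoms [IsNoetherianRing A] : ∃ (ι : Type u) (_ : Fintype ι) (p : ι → A),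
    (∀ i, IsIdempotentElem (p i)) ∧ ∑ i, p i = 1 ∧
      ∀ i, ∀ f : A, IsIdempotentElem f → p i * f = 0 ∨ p i * f = p i := by
  classical
  let S := (finite_isIdempotentElem (A := A)).toFinset
  have hS (f : A) : f ∈ S ↔ IsIdempotentElem f := by simp [S]
  let P (T : Finset A) : A := (∏ f ∈ T, f) * ∏ f ∈ S \ T, (1 - f)
  refine ⟨{T : Finset A // T ∈ S.powerset}, inferInstance, fun T => P T.1, ?_, ?_, ?_⟩
  · rintro ⟨T, hT⟩
    have hT := Finset.mem_powerset.1 hT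
    refine IsIdempotentElem.mul ?_ ?_
    · change _ * _ = _
      rw [← Finset.prod_mul_distrib]
      exact Finset.prod_congr rfl fun f hf => ((hS f).1 (hT hf)).eq
    · change _ * _ = _
      rw [← Finset.prod_mul_distrib]
      exact Finset.prod_congr rfl fun f hf => ((hS f).1 (Finset.mem_sdiff.1 hf).1).one_sub.eq
  · rw [Finset.sum_coe_sort S.powerset P, ← Finset.prod_add]
    simp
  · rintro ⟨T, hT⟩ f hf
    by_cases hfT : f ∈ T
    · right
      change P T * f = P T
      have : P T = f * ((∏ g ∈ T.erase f, g) * ∏ f ∈ S \ T, (1 - f)) := by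
        rw [← mul_assoc, Finset.mul_prod_erase T (fun g => g) hfT]
      rw [this, mul_comm, ← mul_assoc, hf.eq]
    · left
      change P T * f = 0
      have hm : f ∈ S \ T := Finset.mem_sdiff.2 ⟨(hS f).2 hf, hfT⟩
      have : P T = (1 - f) * ((∏ g ∈ T, g) * ∏ g ∈ (S \ T).erase f, (1 - g)) := by
        rw [mul_left_comm, Finset.mul_prod_erase (S \ T) (fun g => 1 - g) hm]
      rw [this, mul_comm, ← mul_assoc, mul_sub, mul_one, hf.eq, sub_self, zero_mul]

theorem exists_algHom_ne_zero [Algebra.FiniteType k A] {e : A} (he : IsIdempotentElem e)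
    (h0 : e ≠ 0) : ∃ φ : A →ₐ[k] AlgebraicClosure k, φ e = 1 := by
  have h1 : ¬ IsUnit (1 - e) := fun hu => h0 <| by
    have : e * (1 - e) = 0 * (1 - e) := by rw [mul_sub, mul_one, he.eq, sub_self, zero_mul]
    exact hu.mul_right_cancel this
  obtain ⟨M, hM, hMe⟩ := exists_max_ideal_of_mem_nonunits h1
  let := Ideal.Quotient.field M
  have : Module.Finite k (A ⧸ M) := finite_of_finite_type_of_isJacobsonRing k (A ⧸ M)
  let φ : A →ₐ[k] AlgebraicClosure k := (IsAlgClosed.lift (M := AlgebraicClosure k) (R := k)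
    (S := A ⧸ M)).comp (Ideal.Quotient.mkₐ k M)
  refine ⟨φ, ?_⟩
  have h2 : φ (1 - e) = 0 := by
    have : Ideal.Quotient.mkₐ k M (1 - e) = 0 := Ideal.Quotient.eq_zero_iff_mem.2 hMe
    simp only [φ, AlgHom.comp_apply, this, map_zero]
  rw [map_sub, map_one, sub_eq_zero] at h2
  exact h2.symm

section Tensor
variable {B : Type u} [CommRing B] [Algebra k B]

theorem lift_const_right [IsSepClosed k] [Nontrivial B] {e : A ⊗[k] B} (he : IsIdempotentElem e)
    {q : B} (hq : ∀ f : B, IsIdempotentElem f → q * f = 0 ∨ q * f = q)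
    (x : A →ₐ[k] AlgebraicClosure k) (y y' : B →ₐ[k] AlgebraicClosure k) (hy : y q = 1)
    (hy' : y' q = 1)
    (h : Algebra.TensorProduct.lift x y (fun _ _ => .all _ _) e = 1) :
    Algebra.TensorProduct.lift x y' (fun _ _ => .all _ _) e = 1 := by
  obtain ⟨f, hf, hef⟩ := exists_eq_tmul_of_isIdempotentElem _
    (he.map (Algebra.TensorProduct.map x (AlgHom.id k B)))
  have key (z : B →ₐ[k] AlgebraicClosure k) :
      Algebra.TensorProduct.lift x z (fun _ _ => .all _ _) e = z f := by
    have h1 : Algebra.TensorProduct.lift x z (fun _ _ => .all _ _) =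
        (Algebra.TensorProduct.lift (AlgHom.id k _) z (fun _ _ => .all _ _)).comp
          (Algebra.TensorProduct.map x (AlgHom.id k B)) := by
      ext <;> simp
    rw [h1, AlgHom.comp_apply, hef]
    simp
  rw [key] at h ⊢
  rcases hq f hf with h2 | h2
  · have := congrArg y h2
    rw [map_mul, hy, h, map_zero, one_mul] at this
    exact absurd this one_ne_zero
  · have := congrArg y' h2
    rwa [map_mul, hy', one_mul] at this

theorem mul_tmul_eq [IsSepClosed k] [Algebra.FiniteType k A] [Algebra.FiniteType k B]
    [Nontrivial A] [Nontrivial B]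
    {e : A ⊗[k] B} (he : IsIdempotentElem e) {p : A} {q : B} (hp' : IsIdempotentElem p)
    (hq' : IsIdempotentElem q)
    (hp : ∀ f : A, IsIdempotentElem f → p * f = 0 ∨ p * f = p)
    (hq : ∀ f : B, IsIdempotentElem f → q * f = 0 ∨ q * f = q) :
    e * p ⊗ₜ q = 0 ∨ e * p ⊗ₜ q = p ⊗ₜ q := by
  by_contra! hcon
  have hpq : IsIdempotentElem (p ⊗ₜ[k] q) := by
    change _ * _ = _
    rw [Algebra.TensorProduct.tmul_mul_tmul, hp'.eq, hq'.eq]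
  have : Algebra.FiniteType k (A ⊗[k] B) := .trans (S := A) ‹_› inferInstance
  obtain ⟨φ, hφ⟩ := exists_algHom_ne_zero (k := k) (he.mul hpq) hcon.1
  obtain ⟨ψ, hψ⟩ := exists_algHom_ne_zero (k := k) (he.one_sub.mul hpq) (fun h => hcon.2 <| by
    rw [sub_mul, one_mul, sub_eq_zero] at h
    exact h.symm)
  have hsplit (χ : A ⊗[k] B →ₐ[k] AlgebraicClosure k) : χ = Algebra.TensorProduct.lift
      (χ.comp Algebra.TensorProduct.includeLeft) (χ.comp Algebra.TensorProduct.includeRight)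
      (fun _ _ => .all _ _) := by
    ext <;> simp
  have hsp (χ : A ⊗[k] B →ₐ[k] AlgebraicClosure k) : χ (p ⊗ₜ q) =
      χ.comp Algebra.TensorProduct.includeLeft p * χ.comp Algebra.TensorProduct.includeRight q := by
    simp [← map_mul]
  have hid (a : AlgebraicClosure k) (ha : IsIdempotentElem a) : a = 0 ∨ a = 1 :=
    IsIdempotentElem.iff_eq_zero_or_one.1 ha
  have ones (a b c : AlgebraicClosure k) (ha : IsIdempotentElem a) (hb : IsIdempotentElem b)
      (hc : IsIdempotentElem c) (h : a * (b * c) = 1) : a = 1 ∧ b = 1 ∧ c = 1 := by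
    rcases hid a ha with rfl | rfl <;> rcases hid b hb with rfl | rfl <;>
      rcases hid c hc with rfl | rfl <;>
      first
      | exact ⟨rfl, rfl, rfl⟩
      | exact absurd h (by simp only [mul_zero, mul_one]; exact zero_ne_one)
  rw [map_mul, hsp] at hφ hψ
  obtain ⟨h1, h2, h3⟩ := ones _ _ _ (he.map φ) (hp'.map _) (hq'.map _) hφ
  obtain ⟨h1', h2', h3'⟩ := ones _ _ _ (he.one_sub.map ψ) (hp'.map _) (hq'.map _) hψ
  rw [hsplit φ] at h1
  have h4 := lift_const_right he hq _ _ _ h3 h3' h1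
  have hcomm (x : A →ₐ[k] AlgebraicClosure k) (y : B →ₐ[k] AlgebraicClosure k) :
      Algebra.TensorProduct.lift x y (fun _ _ => .all _ _) e =
      Algebra.TensorProduct.lift y x (fun _ _ => .all _ _)
        (Algebra.TensorProduct.comm k A B e) := by
    have : Algebra.TensorProduct.lift x y (fun _ _ => .all _ _) =
      (Algebra.TensorProduct.lift y x (fun _ _ => .all _ _)).comp
        (Algebra.TensorProduct.comm k A B).toAlgHom := by ext <;> simp
    rw [this]; rfl
  rw [hcomm] at h4
  have h5 := lift_const_right (he.map _) hp _ _ _ h2 h2' h4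
  rw [← hcomm, ← hsplit] at h5
  rw [map_sub, map_one, h5, sub_self] at h1'
  exact zero_ne_one h1'

theorem mem_range_map_of_isIdempotentElem [IsSepClosed k] [Algebra.FiniteType k A]
    [Algebra.FiniteType k B] [Nontrivial A] [Nontrivial B]
    {e : A ⊗[k] B} (he : IsIdempotentElem e) :
    e ∈ (Algebra.TensorProduct.map (pi0 k A).val (pi0 k B).val).range := by
  have : IsNoetherianRing A := Algebra.FiniteType.isNoetherianRing k A
  have : IsNoetherianRing B := Algebra.FiniteType.isNoetherianRing k B
  obtain ⟨ι, _, p, hp, hp1, hpa⟩ := exists_atoms (A := A)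
  obtain ⟨κ, _, q, hq, hq1, hqa⟩ := exists_atoms (A := B)
  have h : e = ∑ i, ∑ j, e * p i ⊗ₜ q j := by
    have h1 (i : ι) : ∑ j, e * p i ⊗ₜ[k] q j = e * p i ⊗ₜ[k] (1 : B) := by
      rw [← Finset.mul_sum, ← tmul_sum, hq1]
    rw [Finset.sum_congr rfl fun i _ => h1 i, ← Finset.mul_sum, ← sum_tmul, hp1,
      ← Algebra.TensorProduct.one_def, mul_one]
  rw [h]
  refine Subalgebra.sum_mem _ fun i _ => Subalgebra.sum_mem _ fun j _ => ?_
  rcases mul_tmul_eq he (hp i) (hq j) (hpa i) (hqa j) with h0 | h0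
  · rw [h0]; exact zero_mem _
  · rw [h0]
    exact ⟨⟨p i, mem_pi0_of_isIdempotentElem (hp i)⟩ ⊗ₜ
      ⟨q j, mem_pi0_of_isIdempotentElem (hq j)⟩,
      Algebra.TensorProduct.map_tmul _ _ _ _⟩

end Tensor
end I

section SubHopf
variable {k : Type u} [Field k] {H : Type u} [CommRing H] [HopfAlgebra k H]

theorem map_val_injective {A B : Type u} [CommRing A] [Algebra k A] [CommRing B] [Algebra k B]
    (S : Subalgebra k A) (T : Subalgebra k B) :
    Function.Injective (Algebra.TensorProduct.map S.val T.val) :=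
  TensorProduct.map_injective_of_flat_flat S.val.toLinearMap T.val.toLinearMap
    Subtype.val_injective Subtype.val_injective

/-- The comultiplication of `H` restricted to a subalgebra that it maps into `S ⊗ S`. -/
noncomputable def subComul (S : Subalgebra k H)
    (hS : ∀ x ∈ S, Coalgebra.comul x ∈ (Algebra.TensorProduct.map S.val S.val).range) :
    S →ₐ[k] S ⊗[k] S :=
  (AlgEquiv.ofInjective _ (map_val_injective S S)).symm.toAlgHom.comp
    (((Bialgebra.comulAlgHom k H).comp S.val).codRestrict _ fun x => hS x x.2)

theorem map_subComul (S : Subalgebra k H)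
    (hS : ∀ x ∈ S, Coalgebra.comul x ∈ (Algebra.TensorProduct.map S.val S.val).range) (x : S) :
    Algebra.TensorProduct.map S.val S.val (subComul S hS x) = Coalgebra.comul (R := k) (x : H) := by
  have := congrArg Subtype.val ((AlgEquiv.ofInjective _ (map_val_injective S S)).apply_symm_apply
    ((((Bialgebra.comulAlgHom k H).comp S.val).codRestrict _ fun x => hS x x.2) x))
  exact this

/-- A subalgebra `S` of a commutative Hopf algebra `H` over a field with `Δ(S) ⊆ S ⊗ S`, stable under
the antipode, is a Hopf algebra with the restricted structure. -/
noncomputable abbrev subHopfAlgebra (S : Subalgebra k H)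
    (hS : ∀ x ∈ S, Coalgebra.comul x ∈ (Algebra.TensorProduct.map S.val S.val).range)
    (hS' : ∀ x ∈ S, HopfAlgebra.antipode k x ∈ S) : HopfAlgebra k S :=
  have h1 : (Algebra.TensorProduct.map S.val S.val).comp (subComul S hS) =
      (Bialgebra.comulAlgHom k H).comp S.val := AlgHom.ext (map_subComul S hS)
  letI : Bialgebra k S := Bialgebra.ofAlgHom (subComul S hS)
    ((Bialgebra.counitAlgHom k H).comp S.val)
    (by
      have hinj : Function.Injective
          (Algebra.TensorProduct.map S.val (Algebra.TensorProduct.map S.val S.val)) :=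
        TensorProduct.map_injective_of_flat_flat S.val.toLinearMap
          (Algebra.TensorProduct.map S.val S.val).toLinearMap
          Subtype.val_injective (map_val_injective S S)
      apply AlgHom.ext
      intro x
      apply hinj
      have h2 : (Algebra.TensorProduct.map S.val (Algebra.TensorProduct.map S.val S.val)).comp
          ((Algebra.TensorProduct.assoc k k k S S S).toAlgHom.comp
            (Algebra.TensorProduct.map (subComul S hS) (.id k S))) =
          ((Algebra.TensorProduct.assoc k k k H H H).toAlgHom.comp
            (Algebra.TensorProduct.map (Bialgebra.comulAlgHom k H) (.id k H))).comp
              (Algebra.TensorProduct.map S.val S.val) := by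
        have h3 : (Algebra.TensorProduct.map S.val (Algebra.TensorProduct.map S.val S.val)).comp
          (Algebra.TensorProduct.assoc k k k S S S).toAlgHom =
          (Algebra.TensorProduct.assoc k k k H H H).toAlgHom.comp
          (Algebra.TensorProduct.map (Algebra.TensorProduct.map S.val S.val) S.val) := by
          apply AlgHom.toLinearMap_injective
          apply TensorProduct.ext_threefold
          intro a b c
          rfl
        rw [← AlgHom.comp_assoc, h3, AlgHom.comp_assoc, ← Algebra.TensorProduct.map_comp, h1,
          AlgHom.comp_assoc, ← Algebra.TensorProduct.map_comp]
        simp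
      have h4 : (Algebra.TensorProduct.map S.val (Algebra.TensorProduct.map S.val S.val)).comp
            (Algebra.TensorProduct.map (.id k S) (subComul S hS)) =
          (Algebra.TensorProduct.map (.id k H) (Bialgebra.comulAlgHom k H)).comp
              (Algebra.TensorProduct.map S.val S.val) := by
        rw [← Algebra.TensorProduct.map_comp, h1, ← Algebra.TensorProduct.map_comp]
        simp
      have e1 := DFunLike.congr_fun h2 (subComul S hS x)
      have e2 := DFunLike.congr_fun h4 (subComul S hS x)
      simp only [AlgHom.comp_apply, map_subComul] at e1 e2 ⊢
      rw [e1, e2]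
      exact Coalgebra.coassoc_apply (R := k) (x : H))
    (by
      have hinj : Function.Injective (Algebra.TensorProduct.map (AlgHom.id k k) S.val) :=
        TensorProduct.map_injective_of_flat_flat LinearMap.id S.val.toLinearMap
          Function.injective_id Subtype.val_injective
      apply AlgHom.ext
      intro x
      apply hinj
      have h2 : (Algebra.TensorProduct.map (AlgHom.id k k) S.val).comp
          (Algebra.TensorProduct.map ((Bialgebra.counitAlgHom k H).comp S.val) (.id k S)) =
          (Algebra.TensorProduct.map (Bialgebra.counitAlgHom k H) (.id k H)).comp
              (Algebra.TensorProduct.map S.val S.val) := by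
        rw [← Algebra.TensorProduct.map_comp, ← Algebra.TensorProduct.map_comp]; rfl
      have e1 := DFunLike.congr_fun h2 (subComul S hS x)
      simp only [AlgHom.comp_apply, map_subComul] at e1 ⊢
      rw [e1]
      refine (Coalgebra.rTensor_counit_comul (R := k) (x : H)).trans ?_
      simp)
    (by
      have hinj : Function.Injective (Algebra.TensorProduct.map S.val (AlgHom.id k k)) :=
        TensorProduct.map_injective_of_flat_flat S.val.toLinearMap LinearMap.id
          Subtype.val_injective Function.injective_id
      apply AlgHom.ext
      intro x
      apply hinj
      have h2 : (Algebra.TensorProduct.map S.val (AlgHom.id k k)).comp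
          (Algebra.TensorProduct.map (.id k S) ((Bialgebra.counitAlgHom k H).comp S.val)) =
          (Algebra.TensorProduct.map (.id k H) (Bialgebra.counitAlgHom k H)).comp
              (Algebra.TensorProduct.map S.val S.val) := by
        rw [← Algebra.TensorProduct.map_comp, ← Algebra.TensorProduct.map_comp]; rfl
      have e1 := DFunLike.congr_fun h2 (subComul S hS x)
      simp only [AlgHom.comp_apply, map_subComul] at e1 ⊢
      rw [e1]
      refine (Coalgebra.lTensor_counit_comul (R := k) (x : H)).trans ?_
      simp)
  HopfAlgebra.ofAlgHom
    (((HopfAlgebra.antipodeAlgHom k H).comp S.val).codRestrict S fun x => hS' x x.2)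
    (by
      apply AlgHom.ext
      intro x
      apply Subtype.val_injective
      have h2 : S.val.comp (Algebra.TensorProduct.lift (((HopfAlgebra.antipodeAlgHom k H).comp
          S.val).codRestrict S fun x => hS' x x.2) (.id k S) fun _ ↦ Commute.all _) =
          (Algebra.TensorProduct.lift (HopfAlgebra.antipodeAlgHom k H) (.id k H)
            fun _ ↦ Commute.all _).comp (Algebra.TensorProduct.map S.val S.val) := by
        apply Algebra.TensorProduct.ext'
        intro a b
        rfl
      have e1 := DFunLike.congr_fun h2 (subComul S hS x)
      simp only [AlgHom.comp_apply, map_subComul] at e1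
      refine e1.trans ?_
      have := HopfAlgebra.mul_antipode_rTensor_comul_apply (R := k) (x : H)
      rw [← Algebra.TensorProduct.lmul'_comp_map]
      exact this)
    (by
      apply AlgHom.ext
      intro x
      apply Subtype.val_injective
      have h2 : S.val.comp (Algebra.TensorProduct.lift (.id k S)
          (((HopfAlgebra.antipodeAlgHom k H).comp
          S.val).codRestrict S fun x => hS' x x.2) fun _ _ ↦ Commute.all _ _) =
          (Algebra.TensorProduct.lift (.id k H) (HopfAlgebra.antipodeAlgHom k H)
            fun _ _ ↦ Commute.all _ _).comp (Algebra.TensorProduct.map S.val S.val) := by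
        apply Algebra.TensorProduct.ext'
        intro a b
        rfl
      have e1 := DFunLike.congr_fun h2 (subComul S hS x)
      simp only [AlgHom.comp_apply, map_subComul] at e1
      refine e1.trans ?_
      have := HopfAlgebra.mul_antipode_lTensor_comul_apply (R := k) (x : H)
      rw [← Algebra.TensorProduct.lmul'_comp_map]
      exact this)
end SubHopf

/-- The `k`-algebra `k^G` of all functions `G → k`, with pointwise operations. (A separate name, since
`G → k` already carries another coalgebra structure.) -/
def FunctionAlgebra (k : Type u) (G : Type u) : Type u := G → k

namespace FunctionAlgebra
variable {k : Type u} [Field k] {G : Type u}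

noncomputable instance : CommRing (FunctionAlgebra k G) := inferInstanceAs (CommRing (G → k))
noncomputable instance : Algebra k (FunctionAlgebra k G) := inferInstanceAs (Algebra k (G → k))
instance [Finite G] : Module.Finite k (FunctionAlgebra k G) :=
  inferInstanceAs (Module.Finite k (G → k))

/-- Evaluation at `g`. -/
noncomputable def ev (g : G) : FunctionAlgebra k G →ₐ[k] k := Pi.evalAlgHom k (fun _ : G => k) g

theorem ext_ev {φ ψ : FunctionAlgebra k G} (h : ∀ g, ev g φ = ev g ψ) : φ = ψ := funext h

/-- Evaluation of an element of `k^G ⊗ k^G` at `(g, h)`. -/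
noncomputable abbrev ev₂ (g h : G) :
    FunctionAlgebra k G ⊗[k] FunctionAlgebra k G →ₐ[k] k :=
  Algebra.TensorProduct.lift (ev g) (ev h) fun _ _ => .all _ _

theorem separated {A B : Type u} [CommRing A] [Algebra k A] [CommRing B] [Algebra k B]
    {ι κ : Type u} (x : ι → A →ₐ[k] k) (y : κ → B →ₐ[k] k)
    (hx : ∀ a, (∀ i, x i a = 0) → a = 0) (hy : ∀ b, (∀ j, y j b = 0) → b = 0)
    (t : A ⊗[k] B)
    (ht : ∀ i j, Algebra.TensorProduct.lift (x i) (y j) (fun _ _ => .all _ _) t = 0) : t = 0 := by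
  classical
  let b := Module.Basis.ofVectorSpace k B
  let E := TensorProduct.equivFinsuppOfBasisRight (M := A) b
  apply E.injective
  rw [map_zero]
  ext m
  apply hx
  intro i
  let L : A ⊗[k] B →ₐ[k] B :=
    Algebra.TensorProduct.lift ((Algebra.ofId k B).comp (x i)) (AlgHom.id k B) (fun _ _ => .all _ _)
  have hL : L t = 0 := by
    apply hy
    intro j
    rw [← ht i j, ← AlgHom.comp_apply]
    congr 1
    ext <;> simp [L]
  have hLE : ∀ s : A ⊗[k] B, b.repr (L s) m = x i (E s m) := by
    intro s
    induction s with
    | zero => simp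
    | tmul a c =>
      have : L (a ⊗ₜ c) = x i a • c := by simp [L, Algebra.ofId_apply, Algebra.smul_def]
      rw [this]
      simp [E, mul_comm]
    | add s t hs ht => simp [hs, ht]
  rw [← hLE, hL]
  simp

theorem ext₂ {s t : FunctionAlgebra k G ⊗[k] FunctionAlgebra k G}
    (h : ∀ g h, ev₂ g h s = ev₂ g h t) : s = t := by
  rw [← sub_eq_zero]
  exact separated ev ev (fun _ h => ext_ev h) (fun _ h => ext_ev h) _
    fun i j => by rw [map_sub, h, sub_self]

theorem ext₃ {s t : FunctionAlgebra k G ⊗[k] (FunctionAlgebra k G ⊗[k] FunctionAlgebra k G)}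
    (h : ∀ g h l, Algebra.TensorProduct.lift (ev g) (ev₂ h l) (fun _ _ => .all _ _) s =
      Algebra.TensorProduct.lift (ev g) (ev₂ h l) (fun _ _ => .all _ _) t) : s = t := by
  rw [← sub_eq_zero]
  refine separated (κ := G × G) ev (fun p => ev₂ p.1 p.2) (fun _ h => ext_ev h)
    (fun b hb => ext₂ fun g h => (hb (g, h)).trans (map_zero _).symm) _
    fun i j => by rw [map_sub, h, sub_self]

/-- The indicator function of `g`. -/
noncomputable def single (g : G) : FunctionAlgebra k G :=
  open Classical in fun h => if h = g then 1 else 0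

open Classical in
theorem ev_single (g h : G) : ev h (single g : FunctionAlgebra k G) = if h = g then 1 else 0 := rfl

variable [Group G] [Finite G]

/-- `δ(φ)(g, h) = φ(g h)`, that is `δ(φ) = ∑ φ(g h) (1_g ⊗ 1_h)`. -/
noncomputable def comulFun (φ : FunctionAlgebra k G) :
    FunctionAlgebra k G ⊗[k] FunctionAlgebra k G :=
  ∑ᶠ p : G × G, ev (p.1 * p.2) φ • (single p.1 ⊗ₜ[k] single p.2)

theorem ev₂_comulFun (g h : G) (φ : FunctionAlgebra k G) :
    ev₂ g h (comulFun φ) = ev (g * h) φ := by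
  classical
  have := Fintype.ofFinite G
  rw [comulFun, finsum_eq_sum_of_fintype, map_sum, Finset.sum_eq_single (g, h)]
  · simp [ev_single]
  · rintro ⟨a, b⟩ _ hab
    have hab' : g = a → ¬ h = b := fun h1 h2 => hab (by rw [h1, h2])
    by_cases h1 : g = a
    · simp [ev_single, hab' h1]
    · simp [ev_single, h1]
  · simp

/-- The comultiplication of `k^G` as an algebra homomorphism. -/
noncomputable def comulHom : FunctionAlgebra k G →ₐ[k]
    FunctionAlgebra k G ⊗[k] FunctionAlgebra k G where
  toFun := comulFun
  map_one' := ext₂ fun g h => by rw [ev₂_comulFun, map_one, map_one]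
  map_mul' φ ψ := ext₂ fun g h => by simp only [map_mul, ev₂_comulFun]
  map_zero' := ext₂ fun g h => by simp only [map_zero, ev₂_comulFun]
  map_add' φ ψ := ext₂ fun g h => by simp only [map_add, ev₂_comulFun]
  commutes' c := ext₂ fun g h => by simp only [AlgHom.commutes, ev₂_comulFun]

theorem ev₂_comulHom (g h : G) (φ : FunctionAlgebra k G) :
    ev₂ g h (comulHom φ) = ev (g * h) φ := ev₂_comulFun g h φ

/-- `i(φ)(g) = φ(g⁻¹)`. -/
noncomputable def antipodeHom : FunctionAlgebra k G →ₐ[k] FunctionAlgebra k G where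
  toFun φ := (fun g => ev g⁻¹ φ : G → k)
  map_one' := rfl
  map_mul' _ _ := rfl
  map_zero' := rfl
  map_add' _ _ := rfl
  commutes' _ := rfl

/-- The comultiplication is `δ(φ)(g, h) = φ(g h)`, the counit is `ε(φ) = φ(1)`. -/
noncomputable instance : Bialgebra k (FunctionAlgebra k G) :=
  Bialgebra.ofAlgHom comulHom (ev 1)
    (by
      apply AlgHom.ext
      intro φ
      apply ext₃
      intro g h l
      have h1 : ((Algebra.TensorProduct.lift (ev g) (ev₂ h l) (fun _ _ => .all _ _)).comp
          ((Algebra.TensorProduct.assoc k k k (FunctionAlgebra k G) (FunctionAlgebra k G)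
            (FunctionAlgebra k G)).toAlgHom.comp
            (Algebra.TensorProduct.map comulHom (.id k (FunctionAlgebra k G))))) = ev₂ (g * h) l := by
        have h3 : (Algebra.TensorProduct.lift (ev g) (ev₂ h l) (fun _ _ => .all _ _)).comp
          (Algebra.TensorProduct.assoc k k k (FunctionAlgebra k G) (FunctionAlgebra k G)
            (FunctionAlgebra k G)).toAlgHom =
          (Algebra.TensorProduct.lift (ev₂ g h) (ev l) (fun _ _ => .all _ _) :
            (FunctionAlgebra k G ⊗[k] FunctionAlgebra k G) ⊗[k] FunctionAlgebra k G →ₐ[k] k) := by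
          apply AlgHom.toLinearMap_injective
          apply TensorProduct.ext_threefold
          intro a b c
          exact (mul_assoc _ _ _).symm
        rw [← AlgHom.comp_assoc, h3]
        apply Algebra.TensorProduct.ext'
        intro a b
        exact congrArg (· * ev l b) (ev₂_comulHom g h a)
      have h2 : ((Algebra.TensorProduct.lift (ev g) (ev₂ h l) (fun _ _ => .all _ _)).comp
            (Algebra.TensorProduct.map (.id k (FunctionAlgebra k G)) comulHom)) = ev₂ g (h * l) := by
        apply Algebra.TensorProduct.ext'
        intro a b
        exact congrArg (ev g a * ·) (ev₂_comulHom h l b)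
      have e1 := DFunLike.congr_fun h1 (comulHom φ)
      have e2 := DFunLike.congr_fun h2 (comulHom φ)
      rw [ev₂_comulHom, AlgHom.comp_apply] at e1 e2
      rw [AlgHom.comp_apply, AlgHom.comp_apply]
      refine Eq.trans ?_ (e1.trans ((congrArg (fun x => ev x φ) (mul_assoc g h l)).trans e2.symm))
      rfl)
    (by
      apply AlgHom.ext
      intro φ
      apply (Algebra.TensorProduct.lid k (FunctionAlgebra k G)).injective
      apply ext_ev
      intro g
      have h1 : (ev g).comp ((Algebra.TensorProduct.lid k (FunctionAlgebra k G)).toAlgHom.comp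
          (Algebra.TensorProduct.map (ev (1 : G)) (.id k (FunctionAlgebra k G)))) = ev₂ 1 g := by
        apply Algebra.TensorProduct.ext'
        intro a b
        rfl
      have e1 := DFunLike.congr_fun h1 (comulHom φ)
      rw [ev₂_comulHom, one_mul] at e1
      refine e1.trans ?_
      simp)
    (by
      apply AlgHom.ext
      intro φ
      apply (Algebra.TensorProduct.rid k k (FunctionAlgebra k G)).injective
      apply ext_ev
      intro g
      have h1 : (ev g).comp ((Algebra.TensorProduct.rid k k (FunctionAlgebra k G)).toAlgHom.comp
          (Algebra.TensorProduct.map (.id k (FunctionAlgebra k G)) (ev (1 : G)))) = ev₂ g 1 := by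
        apply Algebra.TensorProduct.ext'
        intro a b
        exact mul_comm _ _
      have e1 := DFunLike.congr_fun h1 (comulHom φ)
      rw [ev₂_comulHom, mul_one] at e1
      refine e1.trans ?_
      simp)

/-- The antipode is `i(φ)(g) = φ(g⁻¹)`. -/
noncomputable instance : HopfAlgebra k (FunctionAlgebra k G) :=
  HopfAlgebra.ofAlgHom antipodeHom
    (by
      apply AlgHom.ext
      intro φ
      apply ext_ev
      intro g
      have h1 : (ev g).comp (Algebra.TensorProduct.lift antipodeHom (.id k (FunctionAlgebra k G))
          fun _ ↦ Commute.all _) = ev₂ g⁻¹ g := by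
        apply Algebra.TensorProduct.ext'
        intro a b
        rfl
      have e1 := DFunLike.congr_fun h1 (comulHom φ)
      rw [ev₂_comulHom, inv_mul_cancel] at e1
      exact e1)
    (by
      apply AlgHom.ext
      intro φ
      apply ext_ev
      intro g
      have h1 : (ev g).comp (Algebra.TensorProduct.lift (.id k (FunctionAlgebra k G)) antipodeHom
          fun _ _ ↦ Commute.all _ _) = ev₂ g g⁻¹ := by
        apply Algebra.TensorProduct.ext'
        intro a b
        rfl
      have e1 := DFunLike.congr_fun h1 (comulHom φ)
      rw [ev₂_comulHom, mul_inv_cancel] at e1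
      exact e1)

/-- Precomposition with a group homomorphism, as a homomorphism of Hopf algebras. -/
noncomputable def comap {G' : Type u} [Group G'] [Finite G'] (f : G' →* G) :
    FunctionAlgebra k G →ₐc[k] FunctionAlgebra k G' :=
  BialgHom.ofAlgHom
    { toFun := fun φ => (fun g => ev (f g) φ : G' → k)
      map_one' := rfl
      map_mul' := fun _ _ => rfl
      map_zero' := rfl
      map_add' := fun _ _ => rfl
      commutes' := fun _ => rfl }
    (by
      apply AlgHom.ext
      intro φ
      exact congrArg (fun x => ev x φ) (map_one f))
    (by
      apply AlgHom.ext
      intro φ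
      apply ext₂
      intro g h
      refine Eq.trans ?_ (ev₂_comulHom g h _).symm
      refine Eq.trans ?_ (congrArg (fun x => ev x φ) (map_mul f g h)).symm
      refine Eq.trans ?_ (ev₂_comulHom (f g) (f h) φ)
      rw [AlgHom.comp_apply, ← AlgHom.comp_apply]
      refine DFunLike.congr_fun ?_ (comulHom φ)
      apply Algebra.TensorProduct.ext'
      intro a b
      rfl)
end FunctionAlgebra

section Functors

theorem pi0_comul_mem {k : Type u} [Field k] [IsSepClosed k] {H : Type u} [CommRing H]
    [HopfAlgebra k H] [Algebra.FiniteType k H] {x : H} (hx : x ∈ pi0 k H) :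
    Coalgebra.comul (R := k) x ∈
      (Algebra.TensorProduct.map (pi0 k H).val (pi0 k H).val).range := by
  have : Nontrivial H := Bialgebra.nontrivial (R := k)
  have h : pi0 k H ≤ (Algebra.TensorProduct.map (pi0 k H).val (pi0 k H).val).range.comap
      (Bialgebra.comulAlgHom k H) := by
    rw [pi0_eq_adjoin k H]
    refine Algebra.adjoin_le fun e he => ?_
    rw [← pi0_eq_adjoin k H]
    exact mem_range_map_of_isIdempotentElem (IsIdempotentElem.map he (Bialgebra.comulAlgHom k H))
  exact h hx

/-- The Hopf algebra structure of `π₀(H)`, restricted from `H`. -/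
noncomputable instance pi0HopfAlgebra {k : Type u} [Field k] [IsSepClosed k] {H : Type u}
    [CommRing H] [HopfAlgebra k H] [Algebra.FiniteType k H] : HopfAlgebra k (pi0 k H) :=
  subHopfAlgebra (pi0 k H) (fun _ hx => pi0_comul_mem hx)
    (fun _ hx => map_mem_pi0 (HopfAlgebra.antipodeAlgHom k H) hx)

/-- The inclusion `π₀(H) → H` as a homomorphism of Hopf algebras. -/
noncomputable def pi0Incl {k : Type u} [Field k] [IsSepClosed k] (H : Type u)
    [CommRing H] [HopfAlgebra k H] [Algebra.FiniteType k H] : pi0 k H →ₐc[k] H :=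
  BialgHom.ofAlgHom (pi0 k H).val rfl
    (AlgHom.ext fun x => map_subComul (pi0 k H) (fun _ hx => pi0_comul_mem hx) x)

/-- A homomorphism of Hopf algebras `H → H'` restricts to `π₀(H) → π₀(H')`. -/
noncomputable def pi0Map {k : Type u} [Field k] [IsSepClosed k] {H H' : Type u}
    [CommRing H] [HopfAlgebra k H] [Algebra.FiniteType k H]
    [CommRing H'] [HopfAlgebra k H'] [Algebra.FiniteType k H'] (f : H →ₐc[k] H') :
    pi0 k H →ₐc[k] pi0 k H' :=
  BialgHom.ofAlgHom
    (((f : H →ₐ[k] H').comp (pi0 k H).val).codRestrict (pi0 k H')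
      fun x => map_mem_pi0 (f : H →ₐ[k] H') x.2)
    (by
      apply AlgHom.ext
      intro x
      exact CoalgHomClass.counit_comp_apply f (x : H))
    (by
      apply AlgHom.ext
      intro x
      apply map_val_injective (pi0 k H') (pi0 k H')
      refine Eq.trans ?_ (map_subComul (pi0 k H') (fun _ hx => pi0_comul_mem hx) _).symm
      refine Eq.trans ?_ (CoalgHomClass.map_comp_comul_apply f (x : H))
      rw [← map_subComul (pi0 k H) (fun _ hx => pi0_comul_mem hx) x]
      have h : (Algebra.TensorProduct.map (pi0 k H').val (pi0 k H').val).comp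
          (Algebra.TensorProduct.map
            (((f : H →ₐ[k] H').comp (pi0 k H).val).codRestrict (pi0 k H')
              fun x => map_mem_pi0 (f : H →ₐ[k] H') x.2)
            (((f : H →ₐ[k] H').comp (pi0 k H).val).codRestrict (pi0 k H')
              fun x => map_mem_pi0 (f : H →ₐ[k] H') x.2)) =
          (Algebra.TensorProduct.map (f : H →ₐ[k] H') (f : H →ₐ[k] H')).comp
            (Algebra.TensorProduct.map (pi0 k H).val (pi0 k H).val) := by
        apply Algebra.TensorProduct.ext'
        intro a b
        rfl
      exact DFunLike.congr_fun h _)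

/-- The category of commutative Hopf `k`-algebras that are finitely generated as algebras. -/
abbrev FGCommHopfAlgCat (k : Type u) [Field k] :=
  ObjectProperty.FullSubcategory (fun H : CommHopfAlgCat.{u} k => Algebra.FiniteType k H)

instance (k : Type u) [Field k] (H : FGCommHopfAlgCat k) : Algebra.FiniteType k H.obj := H.property

/-- The functor `G ↦ k^G` from the opposite of finite groups to finitely generated commutative Hopf
algebras; a group homomorphism acts by precomposition. -/
noncomputable def constHopf (k : Type u) [Field k] : FiniteGrp.{u}ᵒᵖ ⥤ FGCommHopfAlgCat k where
  obj G := ⟨CommHopfAlgCat.of k (FunctionAlgebra k G.unop),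
    inferInstanceAs (Algebra.FiniteType k (FunctionAlgebra k G.unop))⟩
  map f := ObjectProperty.homMk (CommHopfAlgCat.ofHom (FunctionAlgebra.comap f.unop.hom.hom))

instance {k : Type u} [Field k] [IsSepClosed k] {H : Type u} [CommRing H] [HopfAlgebra k H]
    [Algebra.FiniteType k H] : Finite (WithConv (pi0 k H →ₐ[k] k)) :=
  have : Finite (pi0 k H →ₐ[k] k) := finite_pi0_algHom
  Finite.of_equiv _ (WithConv.equiv _).symm

/-- Precomposition with `π₀(f) : π₀(H) → π₀(H')` on `k`-points. The groups carry the convolution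
product `φ * ψ = (φ ⊗ ψ) ∘ Δ`, which is the meaning of `WithConv`. -/
noncomputable def pointsMap {k : Type u} [Field k] [IsSepClosed k] {H H' : Type u}
    [CommRing H] [HopfAlgebra k H] [Algebra.FiniteType k H]
    [CommRing H'] [HopfAlgebra k H'] [Algebra.FiniteType k H'] (f : H →ₐc[k] H') :
    WithConv (pi0 k H' →ₐ[k] k) →* WithConv (pi0 k H →ₐ[k] k) :=
  MonoidHom.mk' (fun φ => WithConv.toConv (φ.ofConv.comp (pi0Map f : pi0 k H →ₐ[k] pi0 k H')))
    fun φ ψ => WithConv.ofConv_injective (AlgHom.convMul_comp_bialgHom_distrib φ ψ (pi0Map f))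

/-- The functor `H ↦ CAlg_k(π₀(H), k)` to the opposite of the category of finite groups. -/
noncomputable def pi0Points (k : Type u) [Field k] [IsSepClosed k] :
    FGCommHopfAlgCat k ⥤ FiniteGrp.{u}ᵒᵖ where
  obj H := .op (FiniteGrp.of (WithConv (pi0 k H.obj →ₐ[k] k)))
  map f := (FiniteGrp.ofHom (pointsMap f.hom.hom)).op

end Functors

end HopfPi0

/-! Over a separably closed field, `π₀(A)` is generated by the idempotents of `A` (`pi0_eq_adjoin`).
If `A` is finitely generated, it is Noetherian and has finitely many idempotents, so `1` is a sum of
idempotents `p` that are atoms: `p * f` is `0` or `p` for every idempotent `f`. Each idempotent acts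
on `p` as `0` or `1`, so all of `π₀(A)` acts on `p` by scalars, and a nonzero atom is a `k`-point of
`π₀(A)`. Hence evaluation identifies `π₀(A)` with the algebra of functions on its finite set of
points (`bijective_eval_points`). In particular `π₀(A)` is itself finite separable, and so it is the
largest such subalgebra.

For a Hopf algebra `H` this evaluation is an isomorphism of Hopf algebras from `π₀(H)` to
`k^{π₀(H)_k}`, and its inverse followed by `π₀(H) ⊆ H` is the counit of the adjunction. In the other
direction, the indicator functions show that the points of `π₀(k^G)` are exactly the evaluations at
elements of `G` (`bijective_evPoint`). The unit is therefore invertible, which makes the left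
adjoint `k^{(-)}` fully faithful.

The passage to Ind-objects is formal. `Ind F` is a pointwise left Kan extension along a dense fully
faithful functor and preserves filtered colimits of objects of `C`, so `Ind F ⋙ Ind G` is again a
left Kan extension. Unit, counit and triangle identities are then determined by their restrictions
to the original categories, and an invertible unit stays invertible (`isIso_indUnit`).

The two Ind-completions come from one recognition criterion (`nonempty_indPresentation`): filtered
diagrams from the small category have colimits, its objects are compact with respect to them, and
every object is such a colimit. For profinite groups, compactness of an object is the nonemptiness
of cofiltered limits of nonempty finite sets. For Hopf algebras, filtered colimits are created in
commutative algebras, finitely generated `k`-algebras are finitely presented, and every element lies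
in a finitely generated Hopf subalgebra (`exists_isFGHopfSubalgebra`). -/

namespace HopfPi0

/-! ### Extension of functors and adjunctions to Ind-objects -/

section IndExtension
variable {C : Type w} [Category.{v} C] {D : Type w} [Category.{v} D]

/-- The canonical functor from the indexing category of a cocone of shape `K ⋙ ι` to the category of
objects of `C` over its point. -/
abbrev coconeToOver {J : Type*} [Category J] {E : Type*} [Category E] {ι : C ⥤ E} {K : J ⥤ C}
    (c : Cocone (K ⋙ ι)) : J ⥤ CostructuredArrow ι c.pt :=
  c.toCostructuredArrow ⋙ CostructuredArrow.pre K ι c.pt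

/-- Objects of `C` over an object of `Ind C`, and over the corresponding presheaf. -/
noncomputable def overIndEquiv (X : Ind C) :
    CostructuredArrow (Ind.yoneda (C := C)) X ≌
      CostructuredArrow (yoneda (C := C)) ((Ind.inclusion C).obj X) :=
  (CostructuredArrow.post Ind.yoneda (Ind.inclusion C) X).asEquivalence.trans
    (CostructuredArrow.mapNatIso Ind.yonedaCompInclusion)

/-- The inclusion of `Ind C` in presheaves preserves filtered colimits, so `c` becomes a
presentation of an ind-object; for every such presentation the functor to the category of elements
is final. -/
theorem final_coconeToOver_ind {J : Type v} [SmallCategory J] [IsFiltered J] {K : J ⥤ C}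
    (c : Cocone (K ⋙ Ind.yoneda)) (hc : IsColimit c) : (coconeToOver c).Final := by
  let i : K ⋙ Ind.yoneda ⋙ Ind.inclusion C ≅ K ⋙ yoneda :=
    Functor.isoWhiskerLeft K Ind.yonedaCompInclusion
  let P : IndObjectPresentation ((Ind.inclusion C).obj c.pt) :=
    { I := J
      F := K
      ι := i.inv ≫ ((Ind.inclusion C).mapCocone c).ι
      isColimit := (IsColimit.precomposeInvEquiv i _).symm
        (isColimitOfPreserves (Ind.inclusion C) hc) }
  have e : P.toCostructuredArrow ≅ coconeToOver c ⋙ (overIndEquiv c.pt).functor :=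
    NatIso.ofComponents (fun j => CostructuredArrow.isoMk (Iso.refl _) (by
      refine (congrArg (· ≫ _) (yoneda.map_id (K.obj j))).trans ((Category.id_comp _).trans ?_)
      rfl)) (fun f => by
        apply CostructuredArrow.hom_ext
        exact (Category.comp_id _).trans (Category.id_comp _).symm)
  have hP : P.toCostructuredArrow.Final :=
    (fun Q : IndObjectPresentation ((Ind.inclusion C).obj c.pt) =>
      (inferInstance : Q.toCostructuredArrow.Final)) P
  have : (coconeToOver c ⋙ (overIndEquiv c.pt).functor).Final := Functor.final_of_natIso e
  exact (Functor.final_iff_comp_equivalence _ (overIndEquiv c.pt).functor).2 this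

/-- The value of `L` at `c.pt` is a colimit over all objects of `C` above `c.pt`, and by finality
that colimit can be computed over `J`. -/
theorem preservesColimit_of_isPointwiseLeftKanExtension {E : Type*} [Category E] {F : C ⥤ E}
    {L : Ind C ⥤ E} (α : F ⟶ Ind.yoneda ⋙ L) [IsIso α]
    (h : (Functor.LeftExtension.mk L α).IsPointwiseLeftKanExtension)
    {J : Type v} [SmallCategory J] [IsFiltered J] (K : J ⥤ C) :
    PreservesColimit (K ⋙ Ind.yoneda) L where
  preserves {c} hc := by
    have := final_coconeToOver_ind c hc
    have h1 := (Functor.Final.isColimitWhiskerEquiv (coconeToOver c) _).symm (h c.pt)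
    refine ⟨IsColimit.equivOfNatIsoOfIso (Functor.isoWhiskerLeft K (asIso α)) _ _ ?_ h1⟩
    exact Cocone.ext (Iso.refl _) (fun j => by
      refine (Category.comp_id _).trans ?_
      change (inv α).app (K.obj j) ≫ α.app (K.obj j) ≫ L.map (c.ι.app j) = _
      rw [← NatTrans.comp_app_assoc, IsIso.inv_hom_id]
      exact Category.id_comp _)

instance isIso_indMapUnit (F : C ⥤ D) : IsIso (indMapUnit F) :=
  (Functor.isPointwiseLeftKanExtensionOfIsLeftKanExtension _
    (Ind.yoneda.leftKanExtensionUnit (F ⋙ Ind.yoneda))).isIso_hom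

instance (F : C ⥤ D) : (indMap F).IsLeftKanExtension (indMapUnit F) :=
  inferInstanceAs ((Ind.yoneda.leftKanExtension (F ⋙ Ind.yoneda)).IsLeftKanExtension
    (Ind.yoneda.leftKanExtensionUnit (F ⋙ Ind.yoneda)))

instance (F : C ⥤ D) {J : Type v} [SmallCategory J] [IsFiltered J] (K : J ⥤ C) :
    PreservesColimit (K ⋙ Ind.yoneda) (indMap F) :=
  preservesColimit_of_isPointwiseLeftKanExtension (indMapUnit F)
    (Functor.isPointwiseLeftKanExtensionOfIsLeftKanExtension _ _) K

/-- These are the colimits that compute `Ind G`. Their index category need not be small, but a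
presentation of `X` provides a small filtered category with a final functor to it. Since `Ind F`
preserves them, `Ind G ⋙ Ind F` is a left Kan extension as well. -/
instance (F : C ⥤ D) (G : D ⥤ C) (X : Ind D) :
    PreservesColimit (CostructuredArrow.proj Ind.yoneda X ⋙ G ⋙ Ind.yoneda) (indMap F) where
  preserves {c} hc := by
    let P := X.isIndObject_inclusion_obj.presentation
    let q : P.I ⥤ CostructuredArrow Ind.yoneda X :=
      P.toCostructuredArrow ⋙ (overIndEquiv X).inverse
    have h1 := (Functor.Final.isColimitWhiskerEquiv q c).symm hc
    have h2 : IsColimit ((indMap F).mapCocone (c.whisker q)) :=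
      isColimitOfPreserves (K := (q ⋙ CostructuredArrow.proj Ind.yoneda X ⋙ G) ⋙ Ind.yoneda)
        (indMap F) h1
    exact ⟨Functor.Final.isColimitWhiskerEquiv q _ h2⟩

/-- Density says that the identity of `Ind C` is the left Kan extension of `Ind.yoneda` along
itself, which is what allows the unit of `Ind F ⊣ Ind G` to be defined by its restriction to `C`. -/
instance : (Ind.yoneda (C := C)).IsDense where
  isDenseAt X := by
    have := final_coconeToOver_ind (colimit.cocone (X.presentation.F ⋙ Ind.yoneda))
      (colimit.isColimit _)
    exact ⟨Functor.DenseAt.ofIso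
      ((Functor.Final.isColimitWhiskerEquiv
        (coconeToOver (colimit.cocone (X.presentation.F ⋙ Ind.yoneda))) _).1
        (IsColimit.ofIsoColimit (colimit.isColimit (X.presentation.F ⋙ Ind.yoneda))
          (Cocone.ext (Iso.refl _) (fun j =>
            (Category.comp_id _).trans (Category.id_comp _).symm)))) X.colimitPresentationCompYoneda⟩

/-- The comparison that exhibits `Ind G ⋙ Ind F` as a left Kan extension. -/
noncomputable abbrev indMapCompUnit (G : D ⥤ C) (F : C ⥤ D) :
    (G ⋙ Ind.yoneda) ⋙ indMap F ⟶ Ind.yoneda ⋙ indMap G ⋙ indMap F :=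
  Functor.whiskerRight (indMapUnit G) (indMap F) ≫ (Functor.associator _ _ _).hom

instance (G : D ⥤ C) (F : C ⥤ D) :
    (indMap G ⋙ indMap F).IsLeftKanExtension (indMapCompUnit G F) :=
  inferInstance

variable {F : C ⥤ D} {G : D ⥤ C} (adj : F ⊣ G)

/-- The unit of `Ind F ⊣ Ind G`, restricted to `C`. -/
noncomputable def indUnitAux : Ind.yoneda ⟶ Ind.yoneda ⋙ indMap F ⋙ indMap G where
  app X := Ind.yoneda.map (adj.unit.app X) ≫ (indMapUnit G).app (F.obj X) ≫
    (indMap G).map ((indMapUnit F).app X)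
  naturality X Y f := by
    have h1 := (indMapUnit F).naturality f
    have h2 := (indMapUnit G).naturality (F.map f)
    have h3 := adj.unit.naturality f
    dsimp at h1 h2 h3 ⊢
    rw [← Category.assoc, ← Functor.map_comp, h3, Functor.map_comp, Category.assoc,
      reassoc_of% h2, Category.assoc, Category.assoc, ← Functor.map_comp, h1, Functor.map_comp]

/-- The counit of `Ind F ⊣ Ind G`, restricted to `D`. -/
noncomputable def indCounitAux : (G ⋙ Ind.yoneda) ⋙ indMap F ⟶ Ind.yoneda ⋙ 𝟭 (Ind D) where
  app X := (inv (indMapUnit F)).app (G.obj X) ≫ Ind.yoneda.map (adj.counit.app X)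
  naturality X Y f := by
    have h1 := (inv (indMapUnit F)).naturality (G.map f)
    have h3 := adj.counit.naturality f
    dsimp at h1 h3 ⊢
    rw [reassoc_of% h1, Category.assoc, ← Functor.map_comp, h3, Functor.map_comp]

/-- The unit of `Ind F ⊣ Ind G`. -/
noncomputable def indUnit : 𝟭 (Ind C) ⟶ indMap F ⋙ indMap G :=
  Functor.descOfIsLeftKanExtension _ (Ind.yoneda (C := C)).rightUnitor.inv _ (indUnitAux adj)

/-- The counit of `Ind F ⊣ Ind G`. -/
noncomputable def indCounit : indMap G ⋙ indMap F ⟶ 𝟭 (Ind D) :=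
  Functor.descOfIsLeftKanExtension _ (indMapCompUnit G F) _ (indCounitAux adj)

theorem indUnit_app_yoneda (X : C) :
    (indUnit adj).app (Ind.yoneda.obj X) =
      Ind.yoneda.map (adj.unit.app X) ≫ (indMapUnit G).app (F.obj X) ≫
        (indMap G).map ((indMapUnit F).app X) := by
  have := Functor.descOfIsLeftKanExtension_fac_app _ (Ind.yoneda (C := C)).rightUnitor.inv _
    (indUnitAux adj) X
  exact (Category.id_comp _).symm.trans this

theorem indCounit_app_yoneda (X : D) :
    (indMap F).map ((indMapUnit G).app X) ≫ (indCounit adj).app (Ind.yoneda.obj X) =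
      (inv (indMapUnit F)).app (G.obj X) ≫ Ind.yoneda.map (adj.counit.app X) := by
  have := Functor.descOfIsLeftKanExtension_fac_app _ (indMapCompUnit G F) _
    (indCounitAux adj) X
  simp only [indMapCompUnit, NatTrans.comp_app, Functor.associator_hom_app,
    Functor.whiskerRight_app, Category.assoc] at this
  rw [← Category.assoc] at this
  exact (congrArg (· ≫ _) (Category.comp_id _).symm).trans this

/-- An adjunction `F ⊣ G` extends to an adjunction `Ind F ⊣ Ind G`. -/
noncomputable def indAdjunction : indMap F ⊣ indMap G :=
  Adjunction.mkOfUnitCounit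
    { unit := indUnit adj
      counit := indCounit adj
      left_triangle := by
        -- A transformation out of a left Kan extension is determined on the objects of `C`; there
        -- naturality reduces the identity to the corresponding triangle of `adj`.
        apply Functor.hom_ext_of_isLeftKanExtension _ (indMapUnit F)
        ext X
        have h1 := (indMapUnit F).naturality (adj.unit.app X)
        have h2 := (indCounit adj).naturality ((indMapUnit F).app X)
        have h3 := indCounit_app_yoneda adj (F.obj X)
        dsimp at h1 h2 h3 ⊢
        rw [Category.id_comp, indUnit_app_yoneda, Functor.map_comp, Functor.map_comp,
          Category.assoc, Category.assoc, h2, ← Category.assoc, ← h1, reassoc_of% h3,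
          Category.assoc, ← NatTrans.comp_app_assoc, IsIso.hom_inv_id, NatTrans.id_app,
          Category.id_comp, ← Functor.map_comp_assoc, adj.left_triangle_components]
        simp
      right_triangle := by
        apply Functor.hom_ext_of_isLeftKanExtension _ (indMapUnit G)
        ext X
        have h1 := (indMapUnit G).naturality (adj.counit.app X)
        have h2 := (indUnit adj).naturality ((indMapUnit G).app X)
        have h3 := indCounit_app_yoneda adj X
        dsimp at h1 h2 h3 ⊢
        rw [Category.id_comp, reassoc_of% h2, indUnit_app_yoneda, Category.assoc, Category.assoc,
          ← Functor.map_comp, ← Functor.map_comp, h3, ← NatTrans.comp_app_assoc,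
          IsIso.hom_inv_id, NatTrans.id_app, Category.id_comp, ← h1, ← Functor.map_comp_assoc,
          adj.right_triangle_components]
        simp }

/-- The identity of `Ind C` is a left Kan extension, so the unit is invertible as soon as
`indUnitAux` exhibits `Ind F ⋙ Ind G` as a left Kan extension of the same functor. When `adj.unit`
is invertible, `indUnitAux` differs from `indMapCompUnit F G` only by the isomorphism `e` of the
extended functors. -/
theorem isIso_indUnit [IsIso adj.unit] : IsIso (indUnit adj) := by
  rw [← Functor.isLeftKanExtension_iff_isIso (indUnit adj) (Ind.yoneda (C := C)).rightUnitor.inv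
    (indUnitAux adj) (Functor.descOfIsLeftKanExtension_fac _ _ _ _)]
  let e : Ind.yoneda (C := C) ≅ (F ⋙ Ind.yoneda) ⋙ indMap G :=
    NatIso.ofComponents (fun X => Ind.yoneda.mapIso (asIso (adj.unit.app X)) ≪≫
      (asIso (indMapUnit G)).app (F.obj X)) (fun f => by
        have h2 := (indMapUnit G).naturality (F.map f)
        have h3 := adj.unit.naturality f
        dsimp at h2 h3 ⊢
        rw [← Functor.map_comp_assoc, h3, Functor.map_comp, Category.assoc, h2, Category.assoc])
  rw [Functor.isLeftKanExtension_iff_of_iso₂ (indUnitAux adj) (indMapCompUnit F G) e (Iso.refl _)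
    (by ext X; simp [indUnitAux, e])]
  infer_instance

theorem indMap_full_faithful [IsIso adj.unit] : (indMap F).Full ∧ (indMap F).Faithful := by
  have : IsIso (indAdjunction adj).unit := isIso_indUnit adj
  have h := (indAdjunction adj).fullyFaithfulLOfIsIsoUnit
  exact ⟨h.full, h.faithful⟩

end IndExtension

/-! ### Recognition of Ind-completions -/

section IndCriterion
variable {C : Type w} [Category.{v} C] {E : Type w} [Category.{v} E] (ι : C ⥤ E)

/-- Morphisms from `ι X` to the point of the cocone `c` are computed as the filtered colimit of the
morphisms from `X` to the objects of the diagram. -/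
structure IsCompactCocone {J : Type v} [SmallCategory J] {K : J ⥤ C} (c : Cocone (K ⋙ ι)) :
    Prop where
  exists_lift : ∀ (X : C) (f : ι.obj X ⟶ c.pt), ∃ (j : J) (g : X ⟶ K.obj j),
    ι.map g ≫ c.ι.app j = f
  exists_eq : ∀ (X : C) (j : J) (g g' : X ⟶ K.obj j), ι.map g ≫ c.ι.app j = ι.map g' ≫ c.ι.app j →
    ∃ (j' : J) (a : j ⟶ j'), g ≫ K.map a = g' ≫ K.map a

/-- The restricted Yoneda functor `Y ↦ Hom(ι -, Y)`. -/
abbrev nerveAlong : E ⥤ Cᵒᵖ ⥤ Type v := yoneda ⋙ (Functor.whiskeringLeft _ _ _).obj ι.op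

variable {ι}

/-- For a filtered source, finality amounts to two conditions: existence of an arrow to some stage,
and equality of parallel arrows after a later stage. These are the two fields of `IsCompactCocone`.
-/
theorem IsCompactCocone.final {J : Type v} [SmallCategory J] [IsFiltered J] {K : J ⥤ C}
    {c : Cocone (K ⋙ ι)} (hc : IsCompactCocone ι c) : (coconeToOver c).Final := by
  rw [Functor.final_iff_of_isFiltered]
  refine ⟨fun f => ?_, fun {f j} g₁ g₂ => ?_⟩
  · obtain ⟨j, g, hg⟩ := hc.exists_lift f.left f.hom
    exact ⟨j, ⟨CostructuredArrow.homMk g hg⟩⟩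
  · obtain ⟨k, a, h⟩ := hc.exists_eq _ j g₁.left g₂.left
      ((CostructuredArrow.w g₁).trans (CostructuredArrow.w g₂).symm)
    exact ⟨k, a, CostructuredArrow.hom_ext _ _ h⟩

theorem IsCompactCocone.denseAt {J : Type v} [SmallCategory J] [IsFiltered J] {K : J ⥤ C}
    {c : Cocone (K ⋙ ι)} (hc : IsCompactCocone ι c) (h : IsColimit c) : ι.isDenseAt c.pt := by
  have := hc.final
  exact ⟨(Functor.Final.isColimitWhiskerEquiv (coconeToOver c) _).1
    (IsColimit.ofIsoColimit h (Cocone.ext (Iso.refl _) (fun j =>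
      (Category.comp_id _).trans (Category.id_comp _).symm)))⟩

/-- The nerve functor takes compact cocones to colimit cocones. -/
theorem IsCompactCocone.nonempty_isColimit {J : Type v} [SmallCategory J] [IsFiltered J] {K : J ⥤ C}
    {c : Cocone (K ⋙ ι)} (hc : IsCompactCocone ι c) [ι.Full] [ι.Faithful] :
    Nonempty (IsColimit ((nerveAlong ι).mapCocone c)) := by
  refine ⟨evaluationJointlyReflectsColimits _ fun X => ?_⟩
  refine Types.FilteredColimit.isColimitOf' _ _ (fun f => ?_) (fun j f f' h => ?_)
  · obtain ⟨j, g, hg⟩ := hc.exists_lift X.unop f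
    exact ⟨j, ι.map g, hg.symm⟩
  · obtain ⟨g, rfl⟩ := ι.map_surjective (X := X.unop) f
    obtain ⟨g', rfl⟩ := ι.map_surjective (X := X.unop) f'
    obtain ⟨k, a, h⟩ := hc.exists_eq X.unop j g g' h
    refine ⟨k, a, ?_⟩
    change ι.map g ≫ ι.map (K.map a) = ι.map g' ≫ ι.map (K.map a)
    rw [← ι.map_comp, h, ι.map_comp]

/-- For dense `ι`, the object `Y` is the colimit of the objects `ι X` over it. A natural
transformation from `Hom(ι -, Y)` to `Hom(ι -, Z)` is the same as a cocone with point `Z` on that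
diagram, hence the same as a morphism `Y ⟶ Z`. This gives both faithfulness and fullness. -/
instance [ι.IsDense] : (nerveAlong ι).Faithful where
  map_injective {Y _ _ _} h := (ι.denseAt Y).hom_ext' fun X p =>
    congrArg (𝟙 (ι.obj X) ≫ ·) (ConcreteCategory.congr_hom (NatTrans.congr_app h (.op X)) p)

instance [ι.IsDense] : (nerveAlong ι).Full where
  map_surjective {Y Z} f := by
    let c : Cocone (CostructuredArrow.proj ι Y ⋙ ι) :=
      { pt := Z
        ι :=
          { app := fun g => f.app (.op g.left) g.hom
            naturality := fun g₁ g₂ φ => by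
              have h := ConcreteCategory.congr_hom (f.naturality φ.left.op) g₂.hom
              have h2 : ι.map φ.left ≫ g₂.hom = g₁.hom := CostructuredArrow.w φ
              change ι.map φ.left ≫ f.app (.op g₂.left) g₂.hom = f.app (.op g₁.left) g₁.hom ≫ 𝟙 _
              rw [Category.comp_id, ← h2]
              exact h.symm } }
    refine ⟨(ι.denseAt Y).desc c, ?_⟩
    ext X x
    have := (ι.denseAt Y).fac c (.mk x)
    refine Eq.trans ?_ this
    exact congrArg (· ≫ _) (Category.id_comp _).symm

/-- The identification of `ι ⋙ nerveAlong ι` with the Yoneda embedding. -/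
noncomputable def compNerveAlong [ι.Full] [ι.Faithful] : yoneda ≅ ι ⋙ nerveAlong ι :=
  NatIso.ofComponents (fun X => NatIso.ofComponents
    (fun Y => ((Functor.FullyFaithful.ofFullyFaithful ι).homEquiv (X := Y.unop) (Y := X)).toIso)
    (fun f => by ext x; exact ι.map_comp f.unop x))
    (fun f => by ext Y x; exact ι.map_comp x f)

variable (ι) in
/-- A fully faithful functor exhibits its target as the Ind-completion of its source if small
filtered diagrams have colimits in the target, the objects of the source are finitely presentable
with respect to those, and every object of the target is such a colimit. -/
theorem nonempty_indPresentation [ι.Full] [ι.Faithful]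
    (h1 : ∀ (J : Type v) [SmallCategory J] [IsFiltered J] (K : J ⥤ C),
      ∃ c : Cocone (K ⋙ ι), Nonempty (IsColimit c) ∧ IsCompactCocone ι c)
    (h2 : ∀ Y : E, ∃ (J : Type v) (_ : SmallCategory J) (_ : IsFiltered J) (K : J ⥤ C)
      (c : Cocone (K ⋙ ι)), Nonempty (IsColimit c) ∧ Nonempty (c.pt ≅ Y)) :
    Nonempty (IndPresentation ι) := by
  -- The cocone given by `h2` is not assumed compact. The one given by `h1` for the same diagram is,
  -- and uniqueness of colimits identifies the two points.
  have hdense : ι.IsDense := ⟨fun Y => by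
    obtain ⟨J, _, _, K, c, ⟨hc⟩, ⟨e⟩⟩ := h2 Y
    obtain ⟨d, ⟨hd⟩, hd'⟩ := h1 J K
    obtain ⟨h⟩ := hd'.denseAt hd
    exact ⟨h.ofIso (hd.coconePointUniqueUpToIso hc ≪≫ e)⟩⟩
  have hind (Y : E) : IsIndObject ((nerveAlong ι).obj Y) := by
    obtain ⟨J, _, _, K, c, ⟨hc⟩, ⟨e⟩⟩ := h2 Y
    obtain ⟨d, ⟨hd⟩, hd'⟩ := h1 J K
    obtain ⟨h⟩ := hd'.nonempty_isColimit
    let i : K ⋙ yoneda ≅ (K ⋙ ι) ⋙ nerveAlong ι := Functor.isoWhiskerLeft K compNerveAlong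
    have h3 : IsIndObject ((nerveAlong ι).obj d.pt) :=
      .mk (.ofCocone _ ((IsColimit.precomposeHomEquiv i _).symm h))
    exact h3.map ((nerveAlong ι).mapIso (hd.coconePointUniqueUpToIso hc ≪≫ e)).hom
  let N : E ⥤ ObjectProperty.FullSubcategory (IsIndObject (C := C)) :=
    ObjectProperty.lift _ (nerveAlong ι) hind
  -- The nerve sends the colimit in `E` of a presentation of `A` to the colimit of the corresponding
  -- representables, which is `A`.
  have : N.EssSurj := ⟨fun A => by
    let P := A.property.presentation
    obtain ⟨d, ⟨hd⟩, hd'⟩ := h1 P.I P.F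
    obtain ⟨h⟩ := hd'.nonempty_isColimit
    let i : P.F ⋙ yoneda ≅ (P.F ⋙ ι) ⋙ nerveAlong ι := Functor.isoWhiskerLeft P.F compNerveAlong
    exact ⟨d.pt, ⟨ObjectProperty.isoMk _ (((IsColimit.precomposeHomEquiv i _).symm
      h).coconePointUniqueUpToIso P.coconeIsColimit)⟩⟩⟩
  have : N.Full := inferInstanceAs (ObjectProperty.lift _ _ _).Full
  have : N.Faithful := inferInstanceAs (ObjectProperty.lift _ _ _).Faithful
  have : N.IsEquivalence := {}
  let i : ObjectProperty.lift _ yoneda isIndObject_yoneda ≅ ι ⋙ N :=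
    NatIso.ofComponents (fun X => ObjectProperty.isoMk _ (compNerveAlong.app X))
      (fun f => by
        apply ObjectProperty.hom_ext
        exact compNerveAlong.hom.naturality f)
  refine ⟨⟨(Ind.equivalence C).trans N.asEquivalence.symm, ?_⟩⟩
  exact Functor.associator _ _ _ ≪≫ Functor.isoWhiskerLeft _ ((Functor.associator _ _ _).symm ≪≫
      Functor.isoWhiskerRight (Ind.equivalence C).counitIso _ ≪≫ Functor.leftUnitor _) ≪≫
    Functor.isoWhiskerRight i _ ≪≫ Functor.associator _ _ _ ≪≫
    Functor.isoWhiskerLeft ι N.asEquivalence.unitIso.symm ≪≫ Functor.rightUnitor _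

end IndCriterion

/-! ### Points of `π₀` of a finitely generated algebra -/

section Points
variable {k : Type u} [Field k] [IsSepClosed k] {A : Type u} [CommRing A] [Algebra k A]

/-- `π₀(A)` is generated by idempotents, each of which acts on `p` as `0` or `1`; the elements
acting on `p` by a scalar form a subalgebra. -/
theorem exists_mul_eq_smul_of_mem_pi0 {p : A}
    (hp : ∀ f : A, IsIdempotentElem f → p * f = 0 ∨ p * f = p) {x : A} (hx : x ∈ pi0 k A) :
    ∃ c : k, p * x = c • p := by
  rw [pi0_eq_adjoin] at hx
  induction hx using Algebra.adjoin_induction with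
  | mem x hx =>
    rcases hp x hx with h | h
    · exact ⟨0, by rw [h, zero_smul]⟩
    · exact ⟨1, by rw [h, one_smul]⟩
  | algebraMap r => exact ⟨r, by rw [Algebra.smul_def, mul_comm]⟩
  | add x y _ _ hx hy =>
    obtain ⟨c, hc⟩ := hx
    obtain ⟨d, hd⟩ := hy
    exact ⟨c + d, by rw [mul_add, hc, hd, add_smul]⟩
  | mul x y _ _ hx hy =>
    obtain ⟨c, hc⟩ := hx
    obtain ⟨d, hd⟩ := hy
    exact ⟨c * d, by rw [← mul_assoc, hc, smul_mul_assoc, hd, smul_smul]⟩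

/-- A nonzero atom of the Boolean algebra of idempotents gives a point of `π₀(A)`. -/
theorem exists_point_of_atom {p : A} (hp0 : p ≠ 0)
    (hp : ∀ f : A, IsIdempotentElem f → p * f = 0 ∨ p * f = p) :
    ∃ χ : pi0 k A →ₐ[k] k, ∀ x : pi0 k A, p * x = χ x • p := by
  choose c hc using fun x : pi0 k A => exists_mul_eq_smul_of_mem_pi0 hp x.2
  -- As `p` is nonzero, the scalar `c x` is unique, so every identity required of a homomorphism can
  -- be checked after multiplication by `p`.
  have hinj : ∀ a b : k, a • p = b • p → a = b := fun a b h => smul_left_injective k hp0 h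
  refine ⟨AlgHom.ofLinearMap
    { toFun := c
      map_add' := fun x y => hinj _ _ ?_
      map_smul' := fun r x => hinj _ _ ?_ } (hinj _ _ ?_) (fun x y => hinj _ _ ?_), hc⟩
  · rw [← hc, add_smul, ← hc, ← hc, Subalgebra.coe_add, mul_add]
  · rw [← hc, RingHom.id_apply, smul_assoc, ← hc, Subalgebra.coe_smul, mul_smul_comm]
  · change c 1 • p = _
    rw [← hc, one_smul, Subalgebra.coe_one, mul_one]
  · change c (x * y) • p = (c x * c y) • p
    rw [← hc, Subalgebra.coe_mul, ← mul_assoc, hc, smul_mul_assoc, hc, smul_smul]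

variable [Algebra.FiniteType k A]

/-- Each atom `p i` is zero or gives a point `χ` with `p i * x = χ x • p i`, so `x` is annihilated
by all atoms and by their sum `1`. -/
theorem eq_zero_of_forall_point {x : pi0 k A} (hx : ∀ χ : pi0 k A →ₐ[k] k, χ x = 0) : x = 0 := by
  have : IsNoetherianRing A := Algebra.FiniteType.isNoetherianRing k A
  obtain ⟨ι, _, p, hp, hp1, hpa⟩ := exists_atoms (A := A)
  have h (i : ι) : p i * (x : A) = 0 := by
    by_cases h0 : p i = 0
    · rw [h0, zero_mul]
    · obtain ⟨χ, hχ⟩ := exists_point_of_atom (k := k) h0 (hpa i)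
      rw [hχ, hx, zero_smul]
  apply Subtype.ext
  rw [← one_mul (x : A), ← hp1, Finset.sum_mul, Finset.sum_eq_zero fun i _ => h i]
  rfl

/-- The atoms sum to `1`, so `φ` takes the value `1` on some atom `e i`. Since `e i * x` is a scalar
multiple of `e i`, any point with value `1` on `e i` sends `x` to that scalar and so equals `φ`. -/
theorem exists_indicator (φ : pi0 k A →ₐ[k] k) :
    ∃ e : pi0 k A, φ e = 1 ∧ ∀ ψ : pi0 k A →ₐ[k] k, ψ ≠ φ → ψ e = 0 := by
  have : IsNoetherianRing A := Algebra.FiniteType.isNoetherianRing k A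
  obtain ⟨ι, _, p, hp, hp1, hpa⟩ := exists_atoms (A := A)
  let e (i : ι) : pi0 k A := ⟨p i, mem_pi0_of_isIdempotentElem (hp i)⟩
  have he (i : ι) : IsIdempotentElem (e i) := Subtype.ext (hp i)
  have h01 (ψ : pi0 k A →ₐ[k] k) (i : ι) : ψ (e i) = 0 ∨ ψ (e i) = 1 :=
    IsIdempotentElem.iff_eq_zero_or_one.1 ((he i).map ψ)
  have hsum : ∑ i, e i = 1 := Subtype.ext (by rw [AddSubmonoidClass.coe_finsetSum]; exact hp1)
  obtain ⟨i, hi⟩ : ∃ i, φ (e i) ≠ 0 := by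
    by_contra! h
    have := congrArg φ hsum
    rw [map_sum, Finset.sum_eq_zero fun i _ => h i, map_one] at this
    exact zero_ne_one this
  have hi1 := (h01 φ i).resolve_left hi
  refine ⟨e i, hi1, fun ψ hψ => (h01 ψ i).resolve_right fun hψ1 => hψ ?_⟩
  apply AlgHom.ext
  intro x
  obtain ⟨c, hc⟩ := exists_mul_eq_smul_of_mem_pi0 (hpa i) x.2
  have hc' : e i * x = c • e i := Subtype.ext hc
  have h1 := congrArg φ hc'
  have h2 := congrArg ψ hc'
  rw [map_mul, map_smul, hi1, one_mul] at h1
  rw [map_mul, map_smul, hψ1, one_mul] at h2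
  rw [h1, h2]

variable (k A) in
/-- For `A` finitely generated over a separably closed field, `π₀(A)` is the algebra of functions on
its finite set of points. -/
theorem bijective_eval_points : Function.Bijective
    (fun (x : pi0 k A) (χ : pi0 k A →ₐ[k] k) => χ x) := by
  classical
  refine ⟨fun x y h => ?_, fun f => ?_⟩
  · rw [← sub_eq_zero]
    refine eq_zero_of_forall_point fun χ => ?_
    rw [map_sub, sub_eq_zero]
    exact congrFun h χ
  · have : Finite (pi0 k A →ₐ[k] k) := finite_pi0_algHom
    have := Fintype.ofFinite (pi0 k A →ₐ[k] k)
    choose e he1 he0 using fun φ : pi0 k A →ₐ[k] k => exists_indicator φ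
    refine ⟨∑ φ, f φ • e φ, ?_⟩
    funext ψ
    change ψ _ = _
    rw [map_sum, Finset.sum_eq_single ψ]
    · rw [map_smul, he1, smul_eq_mul, mul_one]
    · intro φ _ h
      rw [map_smul, he0 φ ψ h.symm, smul_zero]
    · simp

-- A supremum of finite separable subalgebras has to be shown finite separable. Here it is a finite
-- power of `k`, and so the supremum is attained.
variable (k A) in
theorem isFiniteSeparable_pi0 : IsFiniteSeparable k (pi0 k A) := by
  have : Finite (pi0 k A →ₐ[k] k) := finite_pi0_algHom
  let E : pi0 k A ≃ₐ[k] ((pi0 k A →ₐ[k] k) → k) :=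
    AlgEquiv.ofBijective (AlgHom.pi fun χ => χ) (bijective_eval_points k A)
  exact (isFiniteSeparable_fun _).of_surjective E.symm.toAlgHom E.symm.surjective

end Points

/-! ### The adjunction between finite groups and finitely generated Hopf algebras -/

section EvalHom
variable {k : Type u} [Field k]

/-- Evaluation at the `k`-points of a Hopf algebra with finitely many points. -/
noncomputable def evalHom (k : Type u) [Field k] (P : Type u) [CommRing P] [HopfAlgebra k P]
    [Finite (WithConv (P →ₐ[k] k))] : P →ₐc[k] FunctionAlgebra k (WithConv (P →ₐ[k] k)) :=
  BialgHom.ofAlgHom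
    { toFun := fun x => (fun χ => χ.ofConv x : WithConv (P →ₐ[k] k) → k)
      map_one' := funext fun χ => map_one χ.ofConv
      map_mul' := fun x y => funext fun χ => map_mul χ.ofConv x y
      map_zero' := funext fun χ => map_zero χ.ofConv
      map_add' := fun x y => funext fun χ => map_add χ.ofConv x y
      commutes' := fun r => funext fun χ => χ.ofConv.commutes r }
    (by
      apply AlgHom.ext
      intro x
      rfl)
    (by
      apply AlgHom.ext
      intro x
      -- Evaluated at a pair of points `(g, h)`, both sides are `(g ⊗ h)(Δ x)`: on the right this is
      -- the definition of the convolution product.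
      apply FunctionAlgebra.ext₂
      intro g h
      refine Eq.trans ?_ (FunctionAlgebra.ev₂_comulHom g h _).symm
      rw [AlgHom.comp_apply, ← AlgHom.comp_apply]
      refine DFunLike.congr_fun (f := _) (g := (Algebra.TensorProduct.lmul' k).comp
        (Algebra.TensorProduct.map g.ofConv h.ofConv)) ?_ (Bialgebra.comulAlgHom k P x)
      apply Algebra.TensorProduct.ext'
      intro a b
      exact (Algebra.TensorProduct.lmul'_apply_tmul _ _).symm)

end EvalHom

section Adjunction
variable {k : Type u} [Field k] [IsSepClosed k]

theorem bijective_evalHom_pi0 (H : Type u) [CommRing H] [HopfAlgebra k H]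
    [Algebra.FiniteType k H] : Function.Bijective (evalHom k (pi0 k H)) := by
  have h := bijective_eval_points k H
  let e := WithConv.equiv (pi0 k H →ₐ[k] k)
  exact ((e.arrowCongr (Equiv.refl k)).symm.bijective.comp h)

/-- `π₀(H)` as the Hopf algebra of functions on its group of points. -/
noncomputable def evalEquiv (H : Type u) [CommRing H] [HopfAlgebra k H] [Algebra.FiniteType k H] :
    pi0 k H ≃ₐc[k] FunctionAlgebra k (WithConv (pi0 k H →ₐ[k] k)) :=
  BialgEquiv.ofBijective (evalHom k (pi0 k H)) (bijective_evalHom_pi0 H)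

/-- The counit `k^{π₀(H)_k} ≅ π₀(H) ⊆ H`. -/
noncomputable def counitHom (H : Type u) [CommRing H] [HopfAlgebra k H] [Algebra.FiniteType k H] :
    FunctionAlgebra k (WithConv (pi0 k H →ₐ[k] k)) →ₐc[k] H :=
  (pi0Incl H).comp ((evalEquiv (k := k) H).symm :
    FunctionAlgebra k (WithConv (pi0 k H →ₐ[k] k)) →ₐc[k] pi0 k H)

theorem counitHom_evalHom (H : Type u) [CommRing H] [HopfAlgebra k H] [Algebra.FiniteType k H]
    (x : pi0 k H) : counitHom H (evalHom k (pi0 k H) x) = x :=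
  congrArg Subtype.val ((evalEquiv (k := k) H).symm_apply_apply x)

theorem exists_evalHom_eq (H : Type u) [CommRing H] [HopfAlgebra k H] [Algebra.FiniteType k H]
    (f : FunctionAlgebra k (WithConv (pi0 k H →ₐ[k] k))) : ∃ x, evalHom k (pi0 k H) x = f :=
  (bijective_evalHom_pi0 H).2 f

variable (k) in
/-- An element of `G` as a point of `π₀(k^G)`. -/
noncomputable def evPoint (G : Type u) [Group G] [Finite G] :
    G →* WithConv (pi0 k (FunctionAlgebra k G) →ₐ[k] k) :=
  MonoidHom.mk'
    (fun g => WithConv.toConv ((FunctionAlgebra.ev g).comp (pi0 k (FunctionAlgebra k G)).val))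
    (fun g h : G => by
      apply WithConv.ofConv_injective
      apply AlgHom.ext
      intro x
      have h1 := FunctionAlgebra.ev₂_comulHom g h x.1
      refine h1.symm.trans ?_
      have h2 := map_subComul (pi0 k (FunctionAlgebra k G)) (fun _ hx => pi0_comul_mem hx) x
      refine (congrArg (FunctionAlgebra.ev₂ g h) h2.symm).trans ?_
      rw [← AlgHom.comp_apply]
      refine DFunLike.congr_fun (f := _) (g := (Algebra.TensorProduct.lmul' k).comp
        (Algebra.TensorProduct.map ((FunctionAlgebra.ev g).comp (pi0 k (FunctionAlgebra k G)).val)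
          ((FunctionAlgebra.ev h).comp (pi0 k (FunctionAlgebra k G)).val))) ?_ _
      apply Algebra.TensorProduct.ext'
      intro a b
      exact (Algebra.TensorProduct.lmul'_apply_tmul _ _).symm)

theorem evPoint_apply (G : Type u) [Group G] [Finite G] (g : G)
    (x : pi0 k (FunctionAlgebra k G)) :
    (evPoint k G g).ofConv x = FunctionAlgebra.ev g x.1 := rfl

omit [IsSepClosed k] in
theorem isIdempotentElem_single (G : Type u) [Group G] [Finite G] (g : G) :
    IsIdempotentElem (FunctionAlgebra.single g : FunctionAlgebra k G) := by
  classical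
  apply FunctionAlgebra.ext_ev
  intro h
  rw [map_mul, FunctionAlgebra.ev_single]
  split_ifs <;> simp

/-- Indicator functions are idempotent, so they lie in `π₀(k^G)`, and they separate the elements of
`G`. They sum to `1`, so a point `χ` is nonzero on the indicator of some `g`; then the relation `x *
s g = x(g) • s g` forces `χ` to be evaluation at `g`. -/
theorem bijective_evPoint (G : Type u) [Group G] [Finite G] :
    Function.Bijective (evPoint k G) := by
  classical
  have := Fintype.ofFinite G
  let s (g : G) : pi0 k (FunctionAlgebra k G) :=
    ⟨FunctionAlgebra.single g, mem_pi0_of_isIdempotentElem (isIdempotentElem_single G g)⟩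
  refine ⟨fun g h hgh => ?_, fun χ => ?_⟩
  · have := congrArg (fun χ => χ.ofConv (s g)) hgh
    simp only [evPoint_apply, s, FunctionAlgebra.ev_single, if_true] at this
    by_contra hne
    rw [if_neg (Ne.symm hne)] at this
    exact one_ne_zero this
  · have hsum : ∑ g, s g = 1 := by
      apply Subtype.ext
      apply FunctionAlgebra.ext_ev
      intro h
      rw [AddSubmonoidClass.coe_finsetSum, map_sum]
      simp [s, FunctionAlgebra.ev_single]
    obtain ⟨g, hg⟩ : ∃ g, χ.ofConv (s g) ≠ 0 := by
      by_contra! h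
      have := congrArg χ.ofConv hsum
      rw [map_sum, Finset.sum_eq_zero fun i _ => h i, map_one] at this
      exact zero_ne_one this
    refine ⟨g, ?_⟩
    apply WithConv.ofConv_injective
    apply AlgHom.ext
    intro x
    have hx : x * s g = FunctionAlgebra.ev g x.1 • s g := by
      apply Subtype.ext
      apply FunctionAlgebra.ext_ev
      intro h
      change FunctionAlgebra.ev h (x.1 * FunctionAlgebra.single g) =
        FunctionAlgebra.ev h (FunctionAlgebra.ev g x.1 • FunctionAlgebra.single g)
      rw [map_mul, map_smul, FunctionAlgebra.ev_single]
      split_ifs with h1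
      · rw [h1]; rfl
      · simp
    have := congrArg χ.ofConv hx
    rw [map_mul, map_smul, smul_eq_mul] at this
    exact ((evPoint_apply G g x).trans (mul_right_cancel₀ hg this).symm)

variable (k) in
/-- `G` as the group of points of `π₀(k^G)`. -/
noncomputable def evPointIso (G : FiniteGrp.{u}) :
    G ≅ FiniteGrp.of (WithConv (pi0 k (FunctionAlgebra k G) →ₐ[k] k)) :=
  let e := MulEquiv.ofBijective _ (bijective_evPoint (k := k) G)
  { hom := FiniteGrp.ofHom (evPoint k G)
    inv := FiniteGrp.ofHom e.symm.toMonoidHom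
    hom_inv_id := by
      apply ConcreteCategory.ext
      apply MonoidHom.ext
      exact e.symm_apply_apply
    inv_hom_id := by
      apply ConcreteCategory.ext
      apply MonoidHom.ext
      exact e.apply_symm_apply }

variable (k) in
/-- `G` is the group of points of `π₀(k^G)`, naturally in `G`. -/
noncomputable def pointsConstIso : constHopf k ⋙ pi0Points k ≅ 𝟭 FiniteGrp.{u}ᵒᵖ :=
  NatIso.ofComponents (fun G => (evPointIso k G.unop).op)
    (fun f => Quiver.Hom.unop_inj (by
      apply ConcreteCategory.ext
      apply MonoidHom.ext
      intro g
      rfl))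

variable (k) in
/-- The inclusions `k^{π₀(H)_k} ≅ π₀(H) ⊆ H`, naturally in `H`. -/
noncomputable def constPointsCounit : pi0Points k ⋙ constHopf k ⟶ 𝟭 (FGCommHopfAlgCat k) where
  app H := ObjectProperty.homMk (CommHopfAlgCat.ofHom (counitHom H.obj))
  naturality H H' f := by
    apply ObjectProperty.hom_ext
    apply CommHopfAlgCat.hom_ext
    apply DFunLike.ext
    intro φ
    obtain ⟨x, rfl⟩ := exists_evalHom_eq H.obj φ
    have h1 : FunctionAlgebra.comap (pointsMap f.hom.hom) (evalHom k (pi0 k H.obj) x) =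
      evalHom k (pi0 k H'.obj) (pi0Map f.hom.hom x) := rfl
    change counitHom H'.obj (FunctionAlgebra.comap (pointsMap f.hom.hom)
      (evalHom k (pi0 k H.obj) x)) = f.hom.hom (counitHom H.obj (evalHom k (pi0 k H.obj) x))
    rw [h1, counitHom_evalHom, counitHom_evalHom]
    rfl

variable (k) in
/-- The adjunction `k^{(-)} ⊣ π₀(-)_k`. -/
noncomputable def constPointsAdjunction : constHopf k ⊣ pi0Points k :=
  Adjunction.mkOfUnitCounit
    { unit := (pointsConstIso k).inv
      counit := constPointsCounit k
      left_triangle := by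
        apply NatTrans.ext
        funext G
        -- Precomposition with the inverse of the unit removes the unit from the identity. What
        -- remains is tested on evaluation functions of elements `x` of `π₀(k^G)`, which are all
        -- functions on the points; both sides return `x`.
        rw [← cancel_epi ((constHopf k).map ((pointsConstIso k).hom.app G))]
        have h1 : (constHopf k).map ((pointsConstIso k).hom.app G) ≫
            (constHopf k).map ((pointsConstIso k).inv.app G) = 𝟙 _ := by
          rw [← Functor.map_comp, Iso.hom_inv_id_app]
          exact (constHopf k).map_id _
        dsimp
        rw [Category.id_comp, reassoc_of% h1, Category.comp_id]
        apply ObjectProperty.hom_ext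
        apply CommHopfAlgCat.hom_ext
        apply DFunLike.ext
        intro φ
        obtain ⟨x, rfl⟩ := exists_evalHom_eq ((constHopf k).obj G).obj φ
        exact counitHom_evalHom ((constHopf k).obj G).obj x
      right_triangle := by
        apply NatTrans.ext
        funext H
        dsimp
        -- The same cancellation leaves two points of `π₀(k^{π₀(H)_k})`. An element `x` there is, as
        -- a function, evaluation of some `y` in `π₀(H)`, and both points take the value `χ(y)` on
        -- it.
        rw [Category.id_comp, ← cancel_epi ((pointsConstIso k).hom.app _)]
        refine ((pointsConstIso k).hom_inv_id_app_assoc _ _).trans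
          (Eq.trans ?_ (Category.comp_id _).symm)
        apply Quiver.Hom.unop_inj
        apply ConcreteCategory.ext
        apply MonoidHom.ext
        intro χ
        apply WithConv.ofConv_injective
        apply AlgHom.ext
        intro x
        obtain ⟨y, hy⟩ := exists_evalHom_eq H.obj x.1
        have h1 : pi0Map (counitHom H.obj) x = y := Subtype.ext (by
          rw [← counitHom_evalHom H.obj y, hy]; rfl)
        change χ.ofConv (pi0Map (counitHom H.obj) x) = FunctionAlgebra.ev χ x.1
        rw [h1, ← hy]
        rfl }

/-- The source of full faithfulness, both of `k^{(-)}` and of its Ind-extension. -/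
instance : IsIso (constPointsAdjunction k).unit :=
  inferInstanceAs (IsIso (pointsConstIso k).inv)

end Adjunction

/-! ### Profinite groups as the pro-completion of finite groups -/

section Profinite

/-- A property satisfied by the components of all points of the limit of a cofiltered system of
finite sets is satisfied by everything that comes from some later stage. -/
theorem exists_forall_map_mem {J : Type u} [SmallCategory J] [IsFiltered J] (D : Jᵒᵖ ⥤ Type u)
    [∀ j, Finite (D.obj j)] (j : J) (S : Set (D.obj (.op j)))
    (hS : ∀ s : D.sections, s.1 (.op j) ∈ S) :
    ∃ (j' : J) (a : j ⟶ j'), ∀ x : D.obj (.op j'), D.map a.op x ∈ S := by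
  by_contra! hcon
  -- The counterexamples at the stages after `j` form a cofiltered system of nonempty finite sets,
  -- which has a section.
  let B : (Under j)ᵒᵖ ⥤ Type u :=
    { obj := fun a => {x : D.obj (.op a.unop.right) // D.map a.unop.hom.op x ∉ S}
      map := fun {a b} f => ↾fun x => ⟨D.map f.unop.right.op x.1, by
        have h : D.map b.unop.hom.op (D.map f.unop.right.op x.1) = D.map a.unop.hom.op x.1 := by
          exact (ConcreteCategory.congr_hom (D.map_comp f.unop.right.op b.unop.hom.op) x.1).symm.trans
            (ConcreteCategory.congr_hom (congrArg (fun t => D.map t.op) (Under.w f.unop)) x.1)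
        rw [h]
        exact x.2⟩
      map_id := fun a => by
        ext x
        exact ConcreteCategory.congr_hom (D.map_id _) x.1
      map_comp := fun f g => by
        ext x
        exact ConcreteCategory.congr_hom (D.map_comp f.unop.right.op g.unop.right.op) x.1 }
  have (a : (Under j)ᵒᵖ) : Finite (B.obj a) :=
    inferInstanceAs (Finite {x : D.obj (.op a.unop.right) // D.map a.unop.hom.op x ∉ S})
  have (a : (Under j)ᵒᵖ) : Nonempty (B.obj a) := by
    obtain ⟨x, hx⟩ := hcon a.unop.right a.unop.hom
    exact ⟨⟨x, hx⟩⟩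
  obtain ⟨s, hs⟩ := nonempty_sections_of_finite_cofiltered_system B
  let t : ((Under.forget j).op ⋙ D).sections :=
    ⟨fun a => (s a).1, fun {a b} f => congrArg Subtype.val (hs f)⟩
  -- A section over the stages after `j` extends uniquely to the whole system; the component at `j`
  -- of the extension contradicts `hS`.
  obtain ⟨r, hr⟩ := (Functor.bijective_sectionsPrecomp (Under.forget j).op D).2 t
  have h1 : r.1 (.op j) = (s (.op (Under.mk (𝟙 j)))).1 :=
    congrFun (congrArg Subtype.val hr) (.op (Under.mk (𝟙 j)))
  apply (s (.op (Under.mk (𝟙 j)))).2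
  rw [← h1]
  have h2 : D.map (Under.mk (𝟙 j)).hom.op (r.1 (.op j)) = r.1 (.op j) :=
    ConcreteCategory.congr_hom (D.map_id (.op j)) _
  refine h2.symm ▸ hS r

instance : (forget₂ FiniteGrp.{u} ProfiniteGrp.{u}).Full where
  map_surjective f := ⟨FiniteGrp.ofHom f.hom.toMonoidHom, rfl⟩

instance : (forget₂ FiniteGrp.{u} ProfiniteGrp.{u}).Faithful where
  map_injective {X Y f g} h := by
    apply ConcreteCategory.ext
    apply MonoidHom.ext
    intro x
    exact ConcreteCategory.congr_hom h x

/-- The inclusion of finite groups in profinite groups, on opposite categories. -/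
abbrev finiteGrpOpIncl : FiniteGrp.{u}ᵒᵖ ⥤ ProfiniteGrp.{u}ᵒᵖ :=
  (forget₂ FiniteGrp.{u} ProfiniteGrp.{u}).op

variable {J : Type u} [SmallCategory J] [IsFiltered J] (K : J ⥤ FiniteGrp.{u}ᵒᵖ)

/-- The limit of a cofiltered system of finite groups, as a colimit in the opposite category. -/
noncomputable def profiniteCocone : Cocone (K ⋙ finiteGrpOpIncl) :=
  coconeOfConeLeftOp (ProfiniteGrp.limitCone (K ⋙ finiteGrpOpIncl).leftOp)

noncomputable def isColimitProfiniteCocone : IsColimit (profiniteCocone K) :=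
  isColimitCoconeOfConeLeftOp _ (ProfiniteGrp.limitConeIsLimit (K ⋙ finiteGrpOpIncl).leftOp)

/-- The underlying sets of a system of finite groups. -/
abbrev groupSets : Jᵒᵖ ⥤ Type u := K.leftOp ⋙ forget FiniteGrp.{u}

/-- The sets of pairs of elements of a system of finite groups. -/
abbrev groupPairs : Jᵒᵖ ⥤ Type u where
  obj i := Prod (K.leftOp.obj i) (K.leftOp.obj i)
  map a := ↾fun x => (K.leftOp.map a x.1, K.leftOp.map a x.2)
  map_id i := by
    ext x <;> rw [K.leftOp.map_id] <;> rfl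
  map_comp f g := by
    ext x <;> rw [K.leftOp.map_comp] <;> rfl

/-- Points of the limit from compatible families. -/
def limitPoint (x : ∀ i, (groupSets K).obj i) (hx : x ∈ (groupSets K).sections) :
    (ProfiniteGrp.limitCone (K ⋙ finiteGrpOpIncl).leftOp).pt :=
  ⟨x, fun {_ _} f => hx f⟩

/-- A continuous homomorphism from the limit to a finite group is locally constant, hence factors
through some stage as a map of sets. This map is multiplicative on pairs that come from the limit,
so by `exists_forall_map_mem` it becomes multiplicative on all pairs coming from a later stage. Two
homomorphisms that agree on the limit are equalized at a later stage for the same reason. -/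
theorem isCompactCocone_profiniteCocone : IsCompactCocone finiteGrpOpIncl (profiniteCocone K) where
  exists_eq X j g g' h := by
    let S : Set ((groupSets K).obj (.op j)) := {x | g.unop x = g'.unop x}
    have hS (s : (groupSets K).sections) : s.1 (.op j) ∈ S := by
      have h1 := congrArg Quiver.Hom.unop h
      exact ConcreteCategory.congr_hom h1 (limitPoint K s.1 s.2)
    have (i : Jᵒᵖ) : Finite ((groupSets K).obj i) := inferInstanceAs (Finite (K.leftOp.obj i))
    obtain ⟨j', a, ha⟩ := exists_forall_map_mem (groupSets K) j S hS
    refine ⟨j', a, Quiver.Hom.unop_inj ?_⟩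
    apply ConcreteCategory.ext
    apply MonoidHom.ext
    exact ha
  exists_lift X f := by
    let c := ProfiniteGrp.limitCone (K ⋙ finiteGrpOpIncl).leftOp
    let hc : IsLimit ((forget₂ ProfiniteGrp.{u} Profinite.{u}).mapCone c) :=
      isLimitOfPreserves _ (ProfiniteGrp.limitConeIsLimit (K ⋙ finiteGrpOpIncl).leftOp)
    let f' : c.pt ⟶ ProfiniteGrp.ofFiniteGrp X.unop := f.unop
    have : DiscreteTopology (ProfiniteGrp.ofFiniteGrp X.unop) := ⟨rfl⟩
    let φ : LocallyConstant c.pt (ProfiniteGrp.ofFiniteGrp X.unop) :=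
      ⟨f'.hom, (IsLocallyConstant.iff_continuous _).2 f'.hom.continuous⟩
    obtain ⟨⟨j⟩, g, hg⟩ := Profinite.exists_locallyConstant.{u, u} _ hc φ
    have hg' (x : c.pt) : f' x = g (c.π.app (.op j) x) := DFunLike.congr_fun hg x
    let g' : K.leftOp.obj (.op j) → X.unop := g
    let S : Set ((groupPairs K).obj (.op j)) := {x | g' (x.1 * x.2) = g' x.1 * g' x.2}
    have hS (s : (groupPairs K).sections) : s.1 (.op j) ∈ S := by
      let x := limitPoint K (fun i => (s.1 i).1) (fun {i i'} a => congrArg Prod.fst (s.2 a))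
      let y := limitPoint K (fun i => (s.1 i).2) (fun {i i'} a => congrArg Prod.snd (s.2 a))
      have h1 := map_mul f'.hom x y
      exact (hg' (x * y)).symm.trans (h1.trans (congrArg₂ (· * ·) (hg' x) (hg' y)))
    have (i : Jᵒᵖ) : Finite ((groupPairs K).obj i) :=
      inferInstanceAs (Finite (Prod (K.leftOp.obj i) (K.leftOp.obj i)))
    obtain ⟨j', a, ha⟩ := exists_forall_map_mem (groupPairs K) j S hS
    refine ⟨j', (FiniteGrp.ofHom (MonoidHom.mk' (fun x => g' (K.leftOp.map a.op x))
      fun x y => ?_)).op, Quiver.Hom.unop_inj ?_⟩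
    · rw [map_mul]
      exact ha (x, y)
    · apply ConcreteCategory.ext
      apply DFunLike.ext
      intro x
      refine Eq.trans ?_ (hg' x).symm
      exact congrArg g' (x.2 a.op)

end Profinite

/-- Profinite groups are the pro-completion of finite groups. -/
theorem nonempty_indPresentation_profiniteGrp :
    Nonempty (IndPresentation (forget₂ FiniteGrp.{u} ProfiniteGrp.{u}).op) := by
  refine nonempty_indPresentation _ (fun J _ _ K => ⟨profiniteCocone K,
    ⟨isColimitProfiniteCocone K⟩, isCompactCocone_profiniteCocone K⟩) (fun Y => ?_)
  -- The index category of finite quotients must be nonempty to be filtered; the whole group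
  -- provides an object.
  have : Nonempty (OpenNormalSubgroup Y.unop) :=
    ⟨{ (⊤ : OpenSubgroup Y.unop) with isNormal' := inferInstanceAs (⊤ : Subgroup Y.unop).Normal }⟩
  exact ⟨(OpenNormalSubgroup Y.unop)ᵒᵖ, inferInstance, inferInstance,
    (ProfiniteGrp.toFiniteQuotientFunctor Y.unop).op, Y.unop.cone.op,
    ⟨(ProfiniteGrp.isLimitCone Y.unop).op⟩, ⟨Iso.refl _⟩⟩

/-! ### Filtered colimits of commutative Hopf algebras -/

section Cover
variable {k : Type u} [Field k] {R : Type u} [CommRing R] [Algebra k R]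
  {ι : Type u} {H : ι → Type u} [∀ i, CommRing (H i)] [∀ i, HopfAlgebra k (H i)]

/-- A commutative algebra `R` with a jointly epimorphic family of homomorphisms from Hopf algebras,
and compatible structure maps, is a Hopf algebra. -/
noncomputable abbrev hopfAlgebraOfJointlyEpi (f : ∀ i, H i →ₐ[k] R)
    (hf : ∀ {B : Type u} [CommRing B] [Algebra k B] {g g' : R →ₐ[k] B},
      (∀ i, g.comp (f i) = g'.comp (f i)) → g = g')
    (δ : R →ₐ[k] R ⊗[k] R) (ε : R →ₐ[k] k) (σ : R →ₐ[k] R)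
    (hδ : ∀ i, δ.comp (f i) =
      (Algebra.TensorProduct.map (f i) (f i)).comp (Bialgebra.comulAlgHom k (H i)))
    (hε : ∀ i, ε.comp (f i) = Bialgebra.counitAlgHom k (H i))
    (hσ : ∀ i, σ.comp (f i) = (f i).comp (HopfAlgebra.antipodeAlgHom k (H i))) :
    HopfAlgebra k R :=
  letI : Bialgebra k R := Bialgebra.ofAlgHom δ ε
    (by
      -- Like the other axioms below, coassociativity is an equality of algebra homomorphisms out of
      -- `R`, so it may be tested after each `f i`, where it follows from the axiom in `H i`.
      refine hf fun i => ?_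
      have h1 : (Algebra.TensorProduct.assoc k k k R R R).toAlgHom.comp
          ((Algebra.TensorProduct.map δ (.id k R)).comp
            (Algebra.TensorProduct.map (f i) (f i))) =
          ((Algebra.TensorProduct.map (f i) (Algebra.TensorProduct.map (f i) (f i))).comp
            (Algebra.TensorProduct.assoc k k k (H i) (H i) (H i)).toAlgHom).comp
              (Algebra.TensorProduct.map (Bialgebra.comulAlgHom k (H i)) (.id k (H i))) := by
        have h3 : (Algebra.TensorProduct.assoc k k k R R R).toAlgHom.comp
            (Algebra.TensorProduct.map (Algebra.TensorProduct.map (f i) (f i)) (f i)) =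
            (Algebra.TensorProduct.map (f i) (Algebra.TensorProduct.map (f i) (f i))).comp
              (Algebra.TensorProduct.assoc k k k (H i) (H i) (H i)).toAlgHom := by
          apply AlgHom.toLinearMap_injective
          apply TensorProduct.ext_threefold
          intro a b c
          rfl
        rw [← h3, AlgHom.comp_assoc, ← Algebra.TensorProduct.map_comp,
          ← Algebra.TensorProduct.map_comp, hδ, AlgHom.id_comp, AlgHom.comp_id]
      have h2 : (Algebra.TensorProduct.map (.id k R) δ).comp
            (Algebra.TensorProduct.map (f i) (f i)) =
          (Algebra.TensorProduct.map (f i) (Algebra.TensorProduct.map (f i) (f i))).comp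
            (Algebra.TensorProduct.map (.id k (H i)) (Bialgebra.comulAlgHom k (H i))) := by
        rw [← Algebra.TensorProduct.map_comp, ← Algebra.TensorProduct.map_comp, hδ,
          AlgHom.id_comp, AlgHom.comp_id]
      apply AlgHom.ext
      intro x
      have e := DFunLike.congr_fun (hδ i) x
      have e1 := DFunLike.congr_fun h1 (Bialgebra.comulAlgHom k (H i) x)
      have e2 := DFunLike.congr_fun h2 (Bialgebra.comulAlgHom k (H i) x)
      simp only [AlgHom.comp_apply] at e e1 e2 ⊢
      rw [e, e1, e2]
      exact congrArg _ (Coalgebra.coassoc_apply (R := k) x))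
    (by
      refine hf fun i => ?_
      rw [AlgHom.comp_assoc, hδ, ← AlgHom.comp_assoc, ← Algebra.TensorProduct.map_comp, hε]
      apply AlgHom.ext
      intro x
      have h : Algebra.TensorProduct.map (Bialgebra.counitAlgHom k (H i))
          ((AlgHom.id k R).comp (f i)) =
        (Algebra.TensorProduct.map (.id k k) (f i)).comp
          (Algebra.TensorProduct.map (Bialgebra.counitAlgHom k (H i)) (.id k (H i))) := by
        rw [← Algebra.TensorProduct.map_comp]
        rfl
      rw [h]
      refine (congrArg (Algebra.TensorProduct.map (.id k k) (f i))
        (Coalgebra.rTensor_counit_comul (R := k) x)).trans ?_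
      simp)
    (by
      refine hf fun i => ?_
      rw [AlgHom.comp_assoc, hδ, ← AlgHom.comp_assoc, ← Algebra.TensorProduct.map_comp, hε]
      apply AlgHom.ext
      intro x
      have h : Algebra.TensorProduct.map ((AlgHom.id k R).comp (f i))
          (Bialgebra.counitAlgHom k (H i)) =
        (Algebra.TensorProduct.map (f i) (.id k k)).comp
          (Algebra.TensorProduct.map (.id k (H i)) (Bialgebra.counitAlgHom k (H i))) := by
        rw [← Algebra.TensorProduct.map_comp]
        rfl
      rw [h]
      refine (congrArg (Algebra.TensorProduct.map (f i) (.id k k))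
        (Coalgebra.lTensor_counit_comul (R := k) x)).trans ?_
      simp)
  HopfAlgebra.ofAlgHom σ
    (by
      refine hf fun i => ?_
      have h : (Algebra.TensorProduct.lift σ (.id k R) fun _ ↦ Commute.all _).comp
          (Algebra.TensorProduct.map (f i) (f i)) =
          (f i).comp (Algebra.TensorProduct.lift (HopfAlgebra.antipodeAlgHom k (H i))
            (.id k (H i)) fun _ ↦ Commute.all _) := by
        apply Algebra.TensorProduct.ext'
        intro a b
        exact (congrArg (· * f i b) (DFunLike.congr_fun (hσ i) a)).trans (map_mul (f i) _ _).symm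
      apply AlgHom.ext
      intro x
      refine (congrArg _ (DFunLike.congr_fun (hδ i) x)).trans
        ((DFunLike.congr_fun h (Bialgebra.comulAlgHom k (H i) x)).trans ?_)
      rw [AlgHom.comp_apply]
      have h1 := HopfAlgebra.mul_antipode_rTensor_comul_apply (R := k) x
      have h2 : ε (f i x) = Coalgebra.counit x := DFunLike.congr_fun (hε i) x
      rw [← Algebra.TensorProduct.lmul'_comp_map]
      refine (congrArg (f i) h1).trans ((AlgHom.commutes _ _).trans ?_)
      exact congrArg (algebraMap k R) h2.symm)
    (by
      refine hf fun i => ?_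
      have h : (Algebra.TensorProduct.lift (.id k R) σ fun _ _ ↦ Commute.all _ _).comp
          (Algebra.TensorProduct.map (f i) (f i)) =
          (f i).comp (Algebra.TensorProduct.lift (.id k (H i))
            (HopfAlgebra.antipodeAlgHom k (H i)) fun _ _ ↦ Commute.all _ _) := by
        apply Algebra.TensorProduct.ext'
        intro a b
        exact (congrArg (f i a * ·) (DFunLike.congr_fun (hσ i) b)).trans (map_mul (f i) _ _).symm
      apply AlgHom.ext
      intro x
      refine (congrArg _ (DFunLike.congr_fun (hδ i) x)).trans
        ((DFunLike.congr_fun h (Bialgebra.comulAlgHom k (H i) x)).trans ?_)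
      rw [AlgHom.comp_apply]
      have h1 := HopfAlgebra.mul_antipode_lTensor_comul_apply (R := k) x
      have h2 : ε (f i x) = Coalgebra.counit x := DFunLike.congr_fun (hε i) x
      rw [← Algebra.TensorProduct.lmul'_comp_map]
      refine (congrArg (f i) h1).trans ((AlgHom.commutes _ _).trans ?_)
      exact congrArg (algebraMap k R) h2.symm)

end Cover

/-- For convolution of algebra homomorphisms `A → B`, the map `S ∘ f` is a left inverse of `f` and
`f ∘ S` is a right inverse, so they coincide. -/
theorem antipode_map {k : Type u} [Field k] {A B : Type u} [CommRing A] [HopfAlgebra k A]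
    [CommRing B] [HopfAlgebra k B] (f : A →ₐc[k] B) (x : A) :
    HopfAlgebra.antipode k (f x) = f (HopfAlgebra.antipode k x) := by
  have h1 : WithConv.toConv ((HopfAlgebra.antipodeAlgHom k B).comp (f : A →ₐ[k] B)) *
      WithConv.toConv (f : A →ₐ[k] B) = 1 := by
    have h := AlgHom.convMul_comp_bialgHom_distrib
      (WithConv.toConv (HopfAlgebra.antipodeAlgHom k B))
      (WithConv.toConv (AlgHom.id k B)) f
    refine (WithConv.ofConv_injective h.symm).trans ?_
    rw [AlgHom.antipode_id_cancel]
    apply WithConv.ofConv_injective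
    apply AlgHom.ext
    intro y
    exact congrArg (algebraMap k B) (CoalgHomClass.counit_comp_apply f y)
  have h2 : WithConv.toConv (f : A →ₐ[k] B) *
      WithConv.toConv ((f : A →ₐ[k] B).comp (HopfAlgebra.antipodeAlgHom k A)) = 1 :=
    mul_inv_cancel (WithConv.toConv (f : A →ₐ[k] B))
  have := left_inv_eq_right_inv h1 h2
  exact DFunLike.congr_fun (WithConv.toConv_injective this) x

section Colimit
variable {k : Type u} [Field k]

/-- The underlying commutative algebra of a commutative Hopf algebra. -/
def forgetToAlg (k : Type u) [Field k] : CommHopfAlgCat.{u} k ⥤ CommAlgCat.{u} k where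
  obj A := .of k A
  map f := CommAlgCat.ofHom (f.hom : _ →ₐ[k] _)

/-- The functor `B ↦ B ⊗ B`. -/
noncomputable def tensorSquare (k : Type u) [Field k] : CommAlgCat.{u} k ⥤ CommAlgCat.{u} k where
  obj B := .of k (B ⊗[k] B)
  map f := CommAlgCat.ofHom (Algebra.TensorProduct.map f.hom f.hom)
  map_id _ := CommAlgCat.hom_ext (Algebra.TensorProduct.ext' fun _ _ => rfl)
  map_comp _ _ := CommAlgCat.hom_ext (Algebra.TensorProduct.ext' fun _ _ => rfl)

variable {J : Type u} [SmallCategory J]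

/-- The cocone of left factors of a cocone over a tensor square. -/
noncomputable def coconeLeft {D : J ⥤ CommAlgCat.{u} k} (s : Cocone (D ⋙ tensorSquare k)) :
    Cocone D where
  pt := s.pt
  ι.app j := CommAlgCat.ofHom (Algebra.TensorProduct.includeLeft (A := D.obj j) (B := D.obj j)) ≫
    s.ι.app j
  ι.naturality j j' a := by
    refine Eq.trans ?_ (Category.comp_id _).symm
    rw [← s.w a]
    apply CommAlgCat.hom_ext
    apply AlgHom.ext
    intro x
    refine congrArg (s.ι.app j').hom ?_
    refine Eq.trans ?_ (Algebra.TensorProduct.map_tmul (D.map a).hom (D.map a).hom x 1).symm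
    rw [map_one]
    rfl

/-- The cocone of right factors of a cocone over a tensor square. -/
noncomputable def coconeRight {D : J ⥤ CommAlgCat.{u} k} (s : Cocone (D ⋙ tensorSquare k)) :
    Cocone D where
  pt := s.pt
  ι.app j := CommAlgCat.ofHom (Algebra.TensorProduct.includeRight (A := D.obj j) (B := D.obj j)) ≫
    s.ι.app j
  ι.naturality j j' a := by
    refine Eq.trans ?_ (Category.comp_id _).symm
    rw [← s.w a]
    apply CommAlgCat.hom_ext
    apply AlgHom.ext
    intro x
    refine congrArg (s.ι.app j').hom ?_
    refine Eq.trans ?_ (Algebra.TensorProduct.map_tmul (D.map a).hom (D.map a).hom 1 x).symm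
    rw [map_one]
    rfl

/-- The tensor square, being a coproduct, preserves colimits. -/
noncomputable def isColimitTensorSquare {D : J ⥤ CommAlgCat.{u} k} {c : Cocone D}
    (hc : IsColimit c) : IsColimit ((tensorSquare k).mapCocone c) where
  desc s := CommAlgCat.ofHom (Algebra.TensorProduct.lift
    (CommAlgCat.Hom.hom (A := c.pt) (B := s.pt) (hc.desc (coconeLeft s)))
    (CommAlgCat.Hom.hom (A := c.pt) (B := s.pt) (hc.desc (coconeRight s)))
    fun _ _ => Commute.all _ _)
  fac s j := by
    have h1 (x) : (hc.desc (coconeLeft s)).hom ((c.ι.app j).hom x) =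
      (s.ι.app j).hom (x ⊗ₜ 1) := ConcreteCategory.congr_hom (hc.fac (coconeLeft s) j) x
    have h2 (x) : (hc.desc (coconeRight s)).hom ((c.ι.app j).hom x) =
      (s.ι.app j).hom (1 ⊗ₜ x) := ConcreteCategory.congr_hom (hc.fac (coconeRight s) j) x
    apply CommAlgCat.hom_ext
    apply Algebra.TensorProduct.ext'
    intro a b
    refine (congrArg₂ (fun x y : s.pt => x * y) (h1 a) (h2 b)).trans ?_
    refine (map_mul (s.ι.app j).hom _ _).symm.trans (congrArg (s.ι.app j).hom ?_)
    exact (Algebra.TensorProduct.tmul_mul_tmul _ _ _ _).trans (by rw [mul_one, one_mul])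
  uniq s m hm := by
    have h1 : CommAlgCat.ofHom (Algebra.TensorProduct.includeLeft (A := c.pt) (B := c.pt)) ≫ m =
        hc.desc (coconeLeft s) := by
      refine hc.uniq (coconeLeft s) _ fun j => ?_
      apply CommAlgCat.hom_ext
      apply AlgHom.ext
      intro x
      refine Eq.trans ?_ (ConcreteCategory.congr_hom (hm j) (x ⊗ₜ 1))
      refine congrArg m.hom ?_
      refine Eq.trans ?_ (Algebra.TensorProduct.map_tmul (c.ι.app j).hom (c.ι.app j).hom x 1).symm
      rw [map_one]
      rfl
    have h2 : CommAlgCat.ofHom (Algebra.TensorProduct.includeRight (A := c.pt) (B := c.pt)) ≫ m =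
        hc.desc (coconeRight s) := by
      refine hc.uniq (coconeRight s) _ fun j => ?_
      apply CommAlgCat.hom_ext
      apply AlgHom.ext
      intro x
      refine Eq.trans ?_ (ConcreteCategory.congr_hom (hm j) (1 ⊗ₜ x))
      refine congrArg m.hom ?_
      refine Eq.trans ?_ (Algebra.TensorProduct.map_tmul (c.ι.app j).hom (c.ι.app j).hom 1 x).symm
      rw [map_one]
      rfl
    apply CommAlgCat.hom_ext
    rw [← h1, ← h2]
    apply Algebra.TensorProduct.ext'
    intro a b
    refine Eq.trans (congrArg m.hom ?_) (map_mul m.hom (a ⊗ₜ[k] 1) (1 ⊗ₜ[k] b))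
    exact (by rw [mul_one, one_mul] : (a ⊗ₜ[k] b) = (a * 1) ⊗ₜ[k] (1 * b)).trans
      (Algebra.TensorProduct.tmul_mul_tmul _ _ _ _).symm

/-- A field is Noetherian, so finite type implies finite presentation; the categorical form is then
known for rings under `k`. -/
theorem isFinitelyPresentable_commAlgCat (X : Type u) [CommRing X] [Algebra k X]
    [Algebra.FiniteType k X] : IsFinitelyPresentable.{u} (CommAlgCat.of k X) := by
  have h : Algebra.FinitePresentation k X := Algebra.FinitePresentation.of_finiteType.1 inferInstance
  have : IsFinitelyPresentable.{u}
      ((commAlgCatEquivUnder (.of k)).functor.obj (CommAlgCat.of k X)) :=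
    CommRingCat.isFinitelyPresentable_under _ _
      ((RingHom.finitePresentation_algebraMap (A := k) (B := X)).2 h)
  have hreg := Cardinal.fact_isRegular_aleph0.{u}
  exact (isCardinalPresentable_iff_of_isEquivalence _ _
    (commAlgCatEquivUnder (.of k)).functor).1 this

theorem exists_map_eq_of_isColimit [IsFiltered J] {D : J ⥤ CommAlgCat.{u} k} {c : Cocone D}
    (hc : IsColimit c) {X : CommAlgCat.{u} k} [IsFinitelyPresentable.{u} X] {j : J}
    (f g : X ⟶ D.obj j) (h : f ≫ c.ι.app j = g ≫ c.ι.app j) :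
    ∃ (j' : J) (a : j ⟶ j'), f ≫ D.map a = g ≫ D.map a := by
  obtain ⟨j', a, b, hab⟩ := IsFinitelyPresentable.exists_eq_of_isColimit hc f g h
  -- Finite presentability equalizes `f` and `g` only after two possibly different transition maps
  -- `a` and `b`; these become equal at a later stage.
  refine ⟨IsFiltered.coeq a b, a ≫ IsFiltered.coeqHom a b, ?_⟩
  rw [D.map_comp, ← Category.assoc, hab, Category.assoc, ← D.map_comp,
    ← IsFiltered.coeq_condition a b, D.map_comp]

section HopfColimit
variable {A : J ⥤ CommHopfAlgCat.{u} k} {c : Cocone (A ⋙ forgetToAlg k)} (hc : IsColimit c)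

/-- The legs of a cocone of algebras. -/
noncomputable abbrev leg (c : Cocone (A ⋙ forgetToAlg k)) (j : J) : A.obj j →ₐ[k] c.pt :=
  CommAlgCat.Hom.hom (A := .of k (A.obj j)) (B := c.pt) (c.ι.app j)

include hc in
theorem algHom_ext_of_isColimit {B : Type u} [CommRing B] [Algebra k B] {g g' : c.pt →ₐ[k] B}
    (h : ∀ j, g.comp (leg c j) = g'.comp (leg c j)) : g = g' :=
  congrArg CommAlgCat.Hom.hom
    (hc.hom_ext (f := CommAlgCat.ofHom g) (f' := CommAlgCat.ofHom g') fun j =>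
      CommAlgCat.hom_ext (h j))

/-- The comultiplications, as a cocone. -/
noncomputable def comulDesc : c.pt →ₐ[k] c.pt ⊗[k] c.pt :=
  (hc.desc ⟨(tensorSquare k).obj c.pt,
    { app j := CommAlgCat.ofHom (Bialgebra.comulAlgHom k (A.obj j)) ≫
        (tensorSquare k).map (c.ι.app j)
      naturality j j' a := by
        refine Eq.trans ?_ (Category.comp_id _).symm
        rw [← c.w a, Functor.map_comp]
        apply CommAlgCat.hom_ext
        apply AlgHom.ext
        intro (x : A.obj j)
        exact congrArg ((tensorSquare k).map (c.ι.app j')).hom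
          (CoalgHomClass.map_comp_comul_apply (A.map a).hom x).symm }⟩).hom

theorem comulDesc_comp (j : J) : (comulDesc hc).comp (leg c j) =
    (Algebra.TensorProduct.map (leg c j) (leg c j)).comp
      (Bialgebra.comulAlgHom k (A.obj j)) :=
  congrArg CommAlgCat.Hom.hom (hc.fac _ j)

/-- The counit of a colimit. -/
noncomputable def counitDesc : c.pt →ₐ[k] k :=
  (hc.desc ⟨CommAlgCat.of k k,
    { app j := CommAlgCat.ofHom (Bialgebra.counitAlgHom k (A.obj j))
      naturality j j' a := by
        refine Eq.trans ?_ (Category.comp_id _).symm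
        apply CommAlgCat.hom_ext
        apply AlgHom.ext
        intro (x : A.obj j)
        exact CoalgHomClass.counit_comp_apply (A.map a).hom x }⟩).hom

theorem counitDesc_comp (j : J) : (counitDesc hc).comp (leg c j) =
    Bialgebra.counitAlgHom k (A.obj j) :=
  congrArg CommAlgCat.Hom.hom (hc.fac _ j)

/-- The antipode of a colimit. -/
noncomputable def antipodeDesc : c.pt →ₐ[k] c.pt :=
  (hc.desc ⟨c.pt,
    { app j := CommAlgCat.ofHom (HopfAlgebra.antipodeAlgHom k (A.obj j)) ≫ c.ι.app j
      naturality j j' a := by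
        refine Eq.trans ?_ (Category.comp_id _).symm
        rw [← c.w a]
        apply CommAlgCat.hom_ext
        apply AlgHom.ext
        intro (x : A.obj j)
        exact congrArg (c.ι.app j').hom (antipode_map (A.map a).hom x) }⟩).hom

theorem antipodeDesc_comp (j : J) : (antipodeDesc hc).comp (leg c j) =
    (leg c j).comp (HopfAlgebra.antipodeAlgHom k (A.obj j)) :=
  congrArg CommAlgCat.Hom.hom (hc.fac _ j)

/-- The Hopf algebra structure of a colimit of commutative Hopf algebras. -/
noncomputable abbrev colimitHopfAlgebra : HopfAlgebra k c.pt :=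
  hopfAlgebraOfJointlyEpi (H := fun j => A.obj j) (leg c) (algHom_ext_of_isColimit hc)
    (comulDesc hc) (counitDesc hc) (antipodeDesc hc) (comulDesc_comp hc) (counitDesc_comp hc)
    (antipodeDesc_comp hc)

/-- A colimit of the underlying algebras, as a cocone of Hopf algebras. -/
noncomputable def hopfCocone : Cocone A where
  pt := letI := colimitHopfAlgebra hc; CommHopfAlgCat.of k c.pt
  ι.app j := letI := colimitHopfAlgebra hc; CommHopfAlgCat.ofHom (X := A.obj j) (Y := c.pt)
    (BialgHom.ofAlgHom (leg c j) (counitDesc_comp hc j) (comulDesc_comp hc j).symm)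
  ι.naturality j j' a := by
    refine Eq.trans ?_ (Category.comp_id _).symm
    apply CommHopfAlgCat.hom_ext
    apply DFunLike.ext
    intro x
    exact ConcreteCategory.congr_hom (c.w a) x

/-- The legs of a cocone of Hopf algebras. -/
abbrev hopfLeg (s : Cocone A) (j : J) : A.obj j →ₐc[k] s.pt := (s.ι.app j).hom

/-- The algebra homomorphism out of a colimit of algebras given by a cocone of Hopf algebras. -/
noncomputable def algDesc (s : Cocone A) : c.pt →ₐ[k] s.pt :=
  CommAlgCat.Hom.hom (A := c.pt) (B := .of k s.pt) (hc.desc ((forgetToAlg k).mapCocone s))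

theorem algDesc_leg (s : Cocone A) (j : J) (x : A.obj j) :
    algDesc hc s (leg c j x) = hopfLeg s j x :=
  ConcreteCategory.congr_hom (hc.fac ((forgetToAlg k).mapCocone s) j) x

/-- The forgetful functor to algebras creates colimits. -/
noncomputable def isColimitHopfCocone : IsColimit (hopfCocone hc) where
  desc s := letI := colimitHopfAlgebra hc; CommHopfAlgCat.ofHom (X := c.pt) (Y := s.pt)
    (BialgHom.ofAlgHom (algDesc hc s)
      (algHom_ext_of_isColimit hc fun j => by
        refine Eq.trans ?_ (counitDesc_comp hc j).symm
        apply AlgHom.ext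
        intro x
        refine (congrArg (Coalgebra.counit (R := k)) (algDesc_leg hc s j x)).trans ?_
        exact CoalgHomClass.counit_comp_apply (hopfLeg s j) x)
      (algHom_ext_of_isColimit hc fun j => by
        apply AlgHom.ext
        intro x
        refine Eq.trans ?_ (congrArg (Coalgebra.comul (R := k)) (algDesc_leg hc s j x)).symm
        refine Eq.trans ?_ (CoalgHomClass.map_comp_comul_apply (hopfLeg s j) x)
        refine (congrArg _ (DFunLike.congr_fun (comulDesc_comp hc j) x)).trans ?_
        have h : (Algebra.TensorProduct.map (algDesc hc s) (algDesc hc s)).comp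
            (Algebra.TensorProduct.map (leg c j) (leg c j)) = Algebra.TensorProduct.map
              (hopfLeg s j : A.obj j →ₐ[k] s.pt) (hopfLeg s j : A.obj j →ₐ[k] s.pt) := by
          apply Algebra.TensorProduct.ext'
          intro a b
          exact congrArg₂ (fun x y : s.pt => x ⊗ₜ[k] y) (algDesc_leg hc s j a)
            (algDesc_leg hc s j b)
        exact DFunLike.congr_fun h (Coalgebra.comul (R := k) x)))
  fac s j := by
    apply CommHopfAlgCat.hom_ext
    apply DFunLike.ext
    intro x
    exact algDesc_leg hc s j x
  uniq s m hm := by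
    have h : (forgetToAlg k).map m = hc.desc ((forgetToAlg k).mapCocone s) :=
      hc.uniq ((forgetToAlg k).mapCocone s) _ fun j =>
        ((forgetToAlg k).map_comp _ _).symm.trans (congrArg (forgetToAlg k).map (hm j))
    apply CommHopfAlgCat.hom_ext
    apply DFunLike.ext
    intro x
    exact ConcreteCategory.congr_hom h x

/-- Homomorphisms from a finitely generated Hopf algebra to a filtered colimit factor through some
stage, essentially uniquely. -/
theorem isCompactCocone_hopfCocone [IsFiltered J] {K : J ⥤ FGCommHopfAlgCat k}
    {c : Cocone ((K ⋙ ObjectProperty.ι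
      (fun H : CommHopfAlgCat.{u} k => Algebra.FiniteType k H)) ⋙ forgetToAlg k)}
    (hc : IsColimit c) :
    IsCompactCocone (ObjectProperty.ι (fun H : CommHopfAlgCat.{u} k => Algebra.FiniteType k H))
      (hopfCocone hc) where
  exists_lift X f := by
    have := isFinitelyPresentable_commAlgCat (k := k) X.obj
    -- At first the factorization is only one of algebras.
    obtain ⟨j, g', hg'⟩ := IsFinitelyPresentable.exists_hom_of_isColimit hc
      (X := CommAlgCat.of k X.obj) ((forgetToAlg k).map f)
    let g : X.obj →ₐ[k] (K.obj j).obj := g'.hom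
    let f' : X.obj →ₐc[k] (hopfCocone hc).pt := f.hom
    let f₀ : X.obj →ₐ[k] c.pt := (f' : X.obj →ₐ[k] (hopfCocone hc).pt)
    have hg (x : X.obj) : leg c j (g x) = f₀ x := ConcreteCategory.congr_hom hg' x
    have hf₀ (x : X.obj) : comulDesc hc (f₀ x) =
        Algebra.TensorProduct.map f₀ f₀ (Coalgebra.comul (R := k) x) :=
      (CoalgHomClass.map_comp_comul_apply f' x).symm
    have hg₂ : (Algebra.TensorProduct.map (leg c j) (leg c j)).comp
        (Algebra.TensorProduct.map g g) = Algebra.TensorProduct.map f₀ f₀ := by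
      apply Algebra.TensorProduct.ext'
      intro x y
      exact congrArg₂ (fun x y : c.pt => x ⊗ₜ[k] y) (hg x) (hg y)
    -- The maps `Δ ∘ g` and `(g ⊗ g) ∘ Δ` agree in the tensor square of the colimit. That square is
    -- the colimit of the tensor squares of the stages, so they agree at a later stage.
    obtain ⟨j', a, hab⟩ := exists_map_eq_of_isColimit
      (isColimitTensorSquare hc) (X := CommAlgCat.of k X.obj)
      (CommAlgCat.ofHom ((Bialgebra.comulAlgHom k (K.obj j).obj).comp g))
      (CommAlgCat.ofHom ((Algebra.TensorProduct.map g g).comp (Bialgebra.comulAlgHom k X.obj)))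
      (by
        apply CommAlgCat.hom_ext
        apply AlgHom.ext
        intro (x : X.obj)
        refine (DFunLike.congr_fun (comulDesc_comp hc j) (g x)).symm.trans ?_
        refine (congrArg (comulDesc hc) (hg x)).trans ((hf₀ x).trans ?_)
        exact (DFunLike.congr_fun hg₂ (Coalgebra.comul (R := k) x)).symm)
    let t : (K.obj j).obj →ₐc[k] (K.obj j').obj := (K.map a).hom.hom
    let g₁ : X.obj →ₐ[k] (K.obj j').obj := (t : (K.obj j).obj →ₐ[k] (K.obj j').obj).comp g
    have hg₁ (x : X.obj) : leg c j' (g₁ x) = f₀ x :=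
      (ConcreteCategory.congr_hom (c.w a) (g x)).trans (hg x)
    refine ⟨j', ObjectProperty.homMk (CommHopfAlgCat.ofHom (BialgHom.ofAlgHom g₁ ?_ ?_)), ?_⟩
    -- Compatibility with counits needs no further stage: the counit of a stage is the counit of the
    -- colimit composed with the leg.
    · apply AlgHom.ext
      intro x
      refine (DFunLike.congr_fun (counitDesc_comp hc j') (g₁ x)).symm.trans ?_
      exact (congrArg (counitDesc hc) (hg₁ x)).trans (CoalgHomClass.counit_comp_apply f' x)
    · apply AlgHom.ext
      intro x
      refine Eq.trans ?_ ((ConcreteCategory.congr_hom hab x).symm.trans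
        (CoalgHomClass.map_comp_comul_apply t (g x)))
      rw [AlgHom.comp_apply]
      have h : Algebra.TensorProduct.map g₁ g₁ =
          (Algebra.TensorProduct.map (t : (K.obj j).obj →ₐ[k] (K.obj j').obj)
            (t : (K.obj j).obj →ₐ[k] (K.obj j').obj)).comp (Algebra.TensorProduct.map g g) :=
        Algebra.TensorProduct.map_comp _ _ _ _
      exact DFunLike.congr_fun h _
    · apply CommHopfAlgCat.hom_ext
      apply DFunLike.ext
      intro x
      exact hg₁ x
  exists_eq X j g g' h := by
    have := isFinitelyPresentable_commAlgCat (k := k) X.obj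
    obtain ⟨j', a, hab⟩ := exists_map_eq_of_isColimit hc
      (X := CommAlgCat.of k X.obj) ((forgetToAlg k).map g.hom) ((forgetToAlg k).map g'.hom)
      (congrArg (forgetToAlg k).map h)
    refine ⟨j', a, ?_⟩
    apply ObjectProperty.hom_ext
    apply CommHopfAlgCat.hom_ext
    apply DFunLike.ext
    intro x
    exact ConcreteCategory.congr_hom hab x

end HopfColimit
end Colimit

/-! ### Local finiteness of commutative Hopf algebras -/

section LocalFiniteness
variable {k : Type u} [Field k]

section Linear
variable {M N : Type u} [AddCommGroup M] [Module k M] [AddCommGroup N] [Module k N]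

/-- Contraction of the left factor by a linear form. -/
noncomputable def contractLeft (φ : M →ₗ[k] k) : M ⊗[k] N →ₗ[k] N :=
  TensorProduct.lift ((LinearMap.lsmul k N).comp φ)

/-- Contraction of the right factor by a linear form. -/
noncomputable def contractRight (φ : N →ₗ[k] k) : M ⊗[k] N →ₗ[k] M :=
  TensorProduct.lift ((LinearMap.lsmul k M).comp φ).flip

@[simp]
theorem contractLeft_tmul (φ : M →ₗ[k] k) (m : M) (n : N) :
    contractLeft φ (m ⊗ₜ[k] n) = φ m • n := rfl

@[simp]
theorem contractRight_tmul (φ : N →ₗ[k] k) (m : M) (n : N) :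
    contractRight φ (m ⊗ₜ[k] n) = φ n • m := rfl

/-- The coordinates of a tensor in a basis of `M` are its contractions by the coordinate forms. -/
theorem eq_of_contractLeft {s t : M ⊗[k] N}
    (h : ∀ φ : M →ₗ[k] k, contractLeft φ s = contractLeft φ t) : s = t := by
  classical
  let b := Module.Basis.ofVectorSpace k M
  apply (TensorProduct.equivFinsuppOfBasisLeft (N := N) b).injective
  ext i
  have key (t : M ⊗[k] N) :
      TensorProduct.equivFinsuppOfBasisLeft (N := N) b t i = contractLeft (b.coord i) t := by
    induction t with
    | zero => simp
    | tmul m n => simp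
    | add s t hs ht => simp [hs, ht]
  rw [key, key, h]

theorem eq_of_contractRight {s t : M ⊗[k] N}
    (h : ∀ φ : N →ₗ[k] k, contractRight φ s = contractRight φ t) : s = t := by
  classical
  let b := Module.Basis.ofVectorSpace k N
  apply (TensorProduct.equivFinsuppOfBasisRight (M := M) b).injective
  ext i
  have key (t : M ⊗[k] N) :
      TensorProduct.equivFinsuppOfBasisRight (M := M) b t i = contractRight (b.coord i) t := by
    induction t with
    | zero => simp
    | tmul m n => simp
    | add s t hs ht => simp [hs, ht]
  rw [key, key, h]

/-- A linear retraction `p` onto `C` fixes all contractions of `t`, so applying it in either factor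
leaves `t` unchanged, and hence so does applying it in both. -/
theorem mem_range_map_subtype (C : Submodule k M) (t : M ⊗[k] M)
    (h1 : ∀ φ : M →ₗ[k] k, contractLeft φ t ∈ C) (h2 : ∀ φ : M →ₗ[k] k, contractRight φ t ∈ C) :
    t ∈ LinearMap.range (TensorProduct.map C.subtype C.subtype) := by
  obtain ⟨p, hp⟩ := LinearMap.exists_leftInverse_of_injective C.subtype C.ker_subtype
  have hp' {x : M} (hx : x ∈ C) : C.subtype (p x) = x :=
    congrArg Subtype.val (LinearMap.congr_fun hp ⟨x, hx⟩)
  have e1 : TensorProduct.map .id (C.subtype.comp p) t = t := by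
    apply eq_of_contractLeft
    intro φ
    have key (s : M ⊗[k] M) : contractLeft φ (TensorProduct.map .id (C.subtype.comp p) s) =
        C.subtype (p (contractLeft φ s)) := by
      induction s with
      | zero => simp
      | tmul m n => simp
      | add s t hs ht => simp only [map_add, hs, ht]
    rw [key, hp' (h1 φ)]
  have e2 : TensorProduct.map (C.subtype.comp p) .id t = t := by
    apply eq_of_contractRight
    intro φ
    have key (s : M ⊗[k] M) : contractRight φ (TensorProduct.map (C.subtype.comp p) .id s) =
        C.subtype (p (contractRight φ s)) := by
      induction s with
      | zero => simp
      | tmul m n => simp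
      | add s t hs ht => simp only [map_add, hs, ht]
    rw [key, hp' (h2 φ)]
  refine ⟨TensorProduct.map p p t, ?_⟩
  rw [← LinearMap.comp_apply, ← TensorProduct.map_comp]
  refine Eq.trans ?_ e2
  conv_rhs => rw [← e1]
  rw [← LinearMap.comp_apply, ← TensorProduct.map_comp, LinearMap.id_comp, LinearMap.comp_id]

theorem exists_fg_contractLeft_mem (t : M ⊗[k] N) :
    ∃ F : Submodule k N, F.FG ∧ ∀ φ : M →ₗ[k] k, contractLeft φ t ∈ F := by
  induction t with
  | zero => exact ⟨⊥, Submodule.fg_bot, fun φ => by simp⟩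
  | tmul m n => exact ⟨Submodule.span k {n}, Submodule.fg_span_singleton n, fun φ =>
      Submodule.smul_mem _ _ (Submodule.mem_span_singleton_self n)⟩
  | add s t hs ht =>
    obtain ⟨F, hF, hF'⟩ := hs
    obtain ⟨G, hG, hG'⟩ := ht
    exact ⟨F ⊔ G, hF.sup hG, fun φ => by
      rw [map_add]
      exact Submodule.add_mem_sup (hF' φ) (hG' φ)⟩

theorem exists_fg_contractRight_mem (t : M ⊗[k] N) :
    ∃ F : Submodule k M, F.FG ∧ ∀ φ : N →ₗ[k] k, contractRight φ t ∈ F := by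
  induction t with
  | zero => exact ⟨⊥, Submodule.fg_bot, fun φ => by simp⟩
  | tmul m n => exact ⟨Submodule.span k {m}, Submodule.fg_span_singleton m, fun φ =>
      Submodule.smul_mem _ _ (Submodule.mem_span_singleton_self m)⟩
  | add s t hs ht =>
    obtain ⟨F, hF, hF'⟩ := hs
    obtain ⟨G, hG, hG'⟩ := ht
    exact ⟨F ⊔ G, hF.sup hG, fun φ => by
      rw [map_add]
      exact Submodule.add_mem_sup (hF' φ) (hG' φ)⟩

end Linear

section Coalgebra
variable {C : Type u} [AddCommGroup C] [Module k C] [Coalgebra k C]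

/-- The right translate `(φ ⊗ 1) Δ(x)`. -/
noncomputable def translateLeft (φ : C →ₗ[k] k) : C →ₗ[k] C :=
  contractLeft φ ∘ₗ Coalgebra.comul

/-- The left translate `(1 ⊗ φ) Δ(x)`. -/
noncomputable def translateRight (φ : C →ₗ[k] k) : C →ₗ[k] C :=
  contractRight φ ∘ₗ Coalgebra.comul

theorem translateLeft_counit (x : C) : translateLeft (Coalgebra.counit (R := k)) x = x := by
  have key (t : C ⊗[k] C) : contractLeft (Coalgebra.counit (R := k)) t =
      TensorProduct.lid k C (LinearMap.rTensor C Coalgebra.counit t) := by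
    induction t with
    | zero => simp
    | tmul m n => simp
    | add s t hs ht => simp only [map_add, hs, ht]
  refine (key _).trans ?_
  rw [Coalgebra.rTensor_counit_comul]
  simp

theorem translateRight_counit (x : C) : translateRight (Coalgebra.counit (R := k)) x = x := by
  have key (t : C ⊗[k] C) : contractRight (Coalgebra.counit (R := k)) t =
      TensorProduct.rid k C (LinearMap.lTensor C Coalgebra.counit t) := by
    induction t with
    | zero => simp
    | tmul m n => simp
    | add s t hs ht => simp only [map_add, hs, ht]
  refine (key _).trans ?_
  rw [Coalgebra.lTensor_counit_comul]
  simp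

/-- The convolution product of linear forms. -/
noncomputable def formMul (φ ψ : C →ₗ[k] k) : C →ₗ[k] k :=
  ψ ∘ₗ translateLeft φ

/-- Coassociativity: linear forms act on `C` by translation, with composition of translates given by
convolution. On the other side the order of the factors is reversed. -/
theorem translateLeft_translateLeft (φ ψ : C →ₗ[k] k) (x : C) :
    translateLeft ψ (translateLeft φ x) = translateLeft (formMul φ ψ) x := by
  have k1 (t : C ⊗[k] C) : contractLeft (formMul φ ψ) t =
      contractLeft ψ (contractLeft φ
        (TensorProduct.assoc k C C C (LinearMap.rTensor C Coalgebra.comul t))) := by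
    induction t with
    | zero => simp
    | tmul m n =>
      rw [LinearMap.rTensor_tmul]
      change ψ (contractLeft φ (Coalgebra.comul m)) • n = _
      generalize (Coalgebra.comul m : C ⊗[k] C) = s
      induction s with
      | zero => simp
      | tmul a b => simp [mul_smul]
      | add s t hs ht => simp only [map_add, add_smul, add_tmul, hs, ht]
    | add s t hs ht => simp only [map_add, hs, ht]
  have k2 (t : C ⊗[k] C) : Coalgebra.comul (contractLeft φ t) =
      contractLeft φ (LinearMap.lTensor C Coalgebra.comul t) := by
    induction t with
    | zero => simp
    | tmul m n => simp
    | add s t hs ht => simp only [map_add, hs, ht]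
  change contractLeft ψ (Coalgebra.comul (contractLeft φ (Coalgebra.comul x))) =
    contractLeft _ (Coalgebra.comul x)
  rw [k1, k2, Coalgebra.coassoc_apply]

theorem translateRight_translateRight (φ ψ : C →ₗ[k] k) (x : C) :
    translateRight ψ (translateRight φ x) = translateRight (formMul ψ φ) x := by
  have k1 (t : C ⊗[k] C) : contractRight (formMul ψ φ) t =
      contractRight ψ (contractRight φ
        ((TensorProduct.assoc k C C C).symm (LinearMap.lTensor C Coalgebra.comul t))) := by
    induction t with
    | zero => simp
    | tmul m n =>
      rw [LinearMap.lTensor_tmul]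
      change φ (contractLeft ψ (Coalgebra.comul n)) • m = _
      generalize (Coalgebra.comul n : C ⊗[k] C) = s
      induction s with
      | zero => simp
      | tmul a b => simp [mul_smul, mul_comm]
      | add s t hs ht => simp only [map_add, add_smul, tmul_add, hs, ht]
    | add s t hs ht => simp only [map_add, hs, ht]
  have k2 (t : C ⊗[k] C) : Coalgebra.comul (contractRight φ t) =
      contractRight φ (LinearMap.rTensor C Coalgebra.comul t) := by
    induction t with
    | zero => simp
    | tmul m n => simp
    | add s t hs ht => simp only [map_add, hs, ht]
  change contractRight ψ (Coalgebra.comul (contractRight φ (Coalgebra.comul x))) =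
    contractRight _ (Coalgebra.comul x)
  rw [k1, k2, ← Coalgebra.coassoc_apply, LinearEquiv.symm_apply_apply]

/-- Also coassociativity: the two actions contract the outer factors of the same element of `C ⊗ C ⊗
C`, in different orders. -/
theorem translateLeft_translateRight (φ ψ : C →ₗ[k] k) (x : C) :
    translateLeft φ (translateRight ψ x) = translateRight ψ (translateLeft φ x) := by
  have k1 (t : C ⊗[k] C) : contractLeft φ (Coalgebra.comul (contractRight ψ t)) =
      contractLeft φ (contractRight ψ (LinearMap.rTensor C Coalgebra.comul t)) := by
    induction t with
    | zero => simp
    | tmul m n => simp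
    | add s t hs ht => simp only [map_add, hs, ht]
  have k2 (t : C ⊗[k] C) : contractRight ψ (Coalgebra.comul (contractLeft φ t)) =
      contractRight ψ (contractLeft φ (LinearMap.lTensor C Coalgebra.comul t)) := by
    induction t with
    | zero => simp
    | tmul m n => simp
    | add s t hs ht => simp only [map_add, hs, ht]
  have k3 (t : (C ⊗[k] C) ⊗[k] C) : contractLeft φ (contractRight ψ t) =
      contractRight ψ (contractLeft φ (TensorProduct.assoc k C C C t)) := by
    induction t with
    | zero => simp
    | tmul m n =>
      induction m with
      | zero => simp
      | tmul a b =>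
        simp only [TensorProduct.assoc_tmul, contractRight_tmul, contractLeft_tmul, map_smul]
        exact smul_comm _ _ _
      | add s t hs ht => simp only [map_add, add_tmul, hs, ht]
    | add s t hs ht => simp only [map_add, hs, ht]
  change contractLeft φ (Coalgebra.comul (contractRight ψ (Coalgebra.comul x))) =
    contractRight ψ (Coalgebra.comul (contractLeft φ (Coalgebra.comul x)))
  rw [k1, k2, k3, Coalgebra.coassoc_apply]

/-- Every element of a coalgebra lies in a finite-dimensional subcoalgebra. -/
theorem exists_fg_subcoalgebra (x : C) : ∃ F : Submodule k C, F.FG ∧ x ∈ F ∧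
    ∀ y ∈ F, Coalgebra.comul y ∈ LinearMap.range (TensorProduct.map F.subtype F.subtype) := by
  -- The span of all two-sided translates of `x`; it contains `x`, the translate by the counit on
  -- both sides.
  let F : Submodule k C := Submodule.span k
    {y | ∃ φ ψ : C →ₗ[k] k, translateLeft φ (translateRight ψ x) = y}
  refine ⟨F, ?_, Submodule.subset_span ⟨Coalgebra.counit, Coalgebra.counit, ?_⟩, fun y hy =>
    mem_range_map_subtype F _ (fun φ => ?_) (fun φ => ?_)⟩
  -- All translates `translateRight ψ x` lie in the span `G` of a finite set `s`, and for each `y`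
  -- in `s` all `translateLeft φ y` lie in the finitely generated `E y`; so `F` is contained in the
  -- finite sum of the `E y`.
  · obtain ⟨G, hG, hG'⟩ := exists_fg_contractRight_mem (Coalgebra.comul (R := k) x)
    obtain ⟨s, hs⟩ := hG
    choose E hE hE' using fun y : C => exists_fg_contractLeft_mem (Coalgebra.comul (R := k) y)
    have hfg : (⨆ y ∈ s, E y).FG := Submodule.fg_biSup s E fun y _ => hE y
    have := IsNoetherian.iff_fg.2 (Module.Finite.iff_fg.2 hfg)
    refine Submodule.FG.of_le hfg (Submodule.span_le.2 ?_)
    rintro _ ⟨φ, ψ, rfl⟩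
    have h : G ≤ (⨆ y ∈ s, E y).comap (translateLeft φ) := by
      rw [← hs, Submodule.span_le]
      intro y hy
      exact (le_iSup₂_of_le (f := fun y (_ : y ∈ s) => E y) y hy le_rfl) (hE' y φ)
    exact h (hG' ψ)
  · rw [translateRight_counit, translateLeft_counit]
  · have h : F ≤ F.comap (translateLeft φ) := by
      refine Submodule.span_le.2 ?_
      rintro _ ⟨φ', ψ, rfl⟩
      exact Submodule.subset_span ⟨formMul φ' φ, ψ, (translateLeft_translateLeft _ _ _).symm⟩
    exact h hy
  · have h : F ≤ F.comap (translateRight φ) := by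
      refine Submodule.span_le.2 ?_
      rintro _ ⟨φ', ψ, rfl⟩
      refine Submodule.subset_span ⟨φ', formMul φ ψ, ?_⟩
      rw [← translateLeft_translateRight, translateRight_translateRight]
    exact h hy

end Coalgebra

section Hopf
variable {H : Type u} [CommRing H] [HopfAlgebra k H]

/-- In the convolution group of algebra endomorphisms of `H`, `S` is the inverse of the identity and
`S ∘ S` is the inverse of `S`. -/
theorem antipode_antipode (x : H) : HopfAlgebra.antipode k (HopfAlgebra.antipode k x) = x := by
  have h : WithConv.toConv
      ((HopfAlgebra.antipodeAlgHom k H).comp (HopfAlgebra.antipodeAlgHom k H)) =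
      WithConv.toConv (AlgHom.id k H) :=
    inv_inv (WithConv.toConv (AlgHom.id k H))
  exact DFunLike.congr_fun (WithConv.toConv_injective h) x

/-- The map `a ⊗ b ↦ S(b) ⊗ S(a)`. -/
noncomputable def antipodeSwap (k : Type u) [Field k] (H : Type u) [CommRing H] [HopfAlgebra k H] :
    H ⊗[k] H →ₐ[k] H ⊗[k] H :=
  Algebra.TensorProduct.lift
    (Algebra.TensorProduct.includeRight.comp (HopfAlgebra.antipodeAlgHom k H))
    (Algebra.TensorProduct.includeLeft.comp (HopfAlgebra.antipodeAlgHom k H))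
    fun _ _ => Commute.all _ _

theorem antipodeSwap_tmul (a b : H) : antipodeSwap k H (a ⊗ₜ b) =
    HopfAlgebra.antipode k b ⊗ₜ HopfAlgebra.antipode k a := by
  simp [antipodeSwap]

/-- In the convolution group of algebra homomorphisms `H → H ⊗ H`, `Δ` is the product `l * r` of the
two inclusions. Its inverse is `Δ ∘ S` on the one hand, and `r⁻¹ * l⁻¹` on the other, which is the
swapped `S ⊗ S` applied to `Δ`. -/
theorem comul_antipode (x : H) : Coalgebra.comul (HopfAlgebra.antipode k x) =
    antipodeSwap k H (Coalgebra.comul x) := by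
  let l : WithConv (H →ₐ[k] H ⊗[k] H) := WithConv.toConv Algebra.TensorProduct.includeLeft
  let r : WithConv (H →ₐ[k] H ⊗[k] H) := WithConv.toConv Algebra.TensorProduct.includeRight
  have h1 : l * r = WithConv.toConv (Bialgebra.comulAlgHom k H) := by
    apply WithConv.ofConv_injective
    rw [AlgHom.convMul_def]
    have h : (Algebra.TensorProduct.lmul' k).comp (Algebra.TensorProduct.map l.ofConv r.ofConv) =
        AlgHom.id k (H ⊗[k] H) := by
      apply Algebra.TensorProduct.ext'
      intro a b
      simp [l, r]
    exact AlgHom.ext fun y => DFunLike.congr_fun h (Coalgebra.comul (R := k) y)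
  have h2 : r⁻¹ * l⁻¹ = WithConv.toConv ((antipodeSwap k H).comp (Bialgebra.comulAlgHom k H)) := by
    apply WithConv.ofConv_injective
    rw [AlgHom.convMul_def]
    have h : (Algebra.TensorProduct.lmul' k).comp
        (Algebra.TensorProduct.map r⁻¹.ofConv l⁻¹.ofConv) = antipodeSwap k H := by
      apply Algebra.TensorProduct.ext'
      intro a b
      rfl
    exact AlgHom.ext fun y => DFunLike.congr_fun h (Coalgebra.comul (R := k) y)
  have h3 : (WithConv.toConv (Bialgebra.comulAlgHom k H))⁻¹ = r⁻¹ * l⁻¹ :=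
    (congrArg _ h1.symm).trans (mul_inv_rev l r)
  exact DFunLike.congr_fun (WithConv.toConv_injective (h3.trans h2)) x

/-- A finitely generated Hopf subalgebra. -/
structure IsFGHopfSubalgebra (S : Subalgebra k H) : Prop where
  fg : S.FG
  comul_mem : ∀ x ∈ S, Coalgebra.comul (R := k) x ∈ (Algebra.TensorProduct.map S.val S.val).range
  antipode_mem : ∀ x ∈ S, HopfAlgebra.antipode k x ∈ S

theorem range_map_val_mono {S T : Subalgebra k H} (h : S ≤ T) :
    (Algebra.TensorProduct.map S.val S.val).range ≤
      (Algebra.TensorProduct.map T.val T.val).range := by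
  have e : Algebra.TensorProduct.map S.val S.val = (Algebra.TensorProduct.map T.val T.val).comp
      (Algebra.TensorProduct.map (Subalgebra.inclusion h) (Subalgebra.inclusion h)) := by
    apply Algebra.TensorProduct.ext'
    intro a b
    rfl
  rw [e]
  exact AlgHom.range_comp_le_range _ _

theorem tmul_mem_range {S : Subalgebra k H} {a b : H} (ha : a ∈ S) (hb : b ∈ S) :
    a ⊗ₜ[k] b ∈ (Algebra.TensorProduct.map S.val S.val).range :=
  ⟨⟨a, ha⟩ ⊗ₜ ⟨b, hb⟩, rfl⟩

theorem IsFGHopfSubalgebra.sup {S T : Subalgebra k H} (hS : IsFGHopfSubalgebra S)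
    (hT : IsFGHopfSubalgebra T) : IsFGHopfSubalgebra (S ⊔ T) where
  fg := hS.fg.sup hT.fg
  comul_mem := by
    have h : S ⊔ T ≤ (Algebra.TensorProduct.map (S ⊔ T).val (S ⊔ T).val).range.comap
        (Bialgebra.comulAlgHom k H) :=
      sup_le (fun x hx => range_map_val_mono le_sup_left (hS.comul_mem x hx))
        (fun x hx => range_map_val_mono le_sup_right (hT.comul_mem x hx))
    exact fun x hx => h hx
  antipode_mem := by
    have h : S ⊔ T ≤ (S ⊔ T).comap (HopfAlgebra.antipodeAlgHom k H) :=
      sup_le (fun x hx => (le_sup_left : S ≤ S ⊔ T) (hS.antipode_mem x hx))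
        (fun x hx => (le_sup_right : T ≤ S ⊔ T) (hT.antipode_mem x hx))
    exact fun x hx => h hx

/-- Every element of a commutative Hopf algebra lies in a finitely generated Hopf subalgebra. -/
theorem exists_isFGHopfSubalgebra (x : H) : ∃ S : Subalgebra k H, IsFGHopfSubalgebra S ∧ x ∈ S := by
  obtain ⟨F, ⟨s, hs⟩, hx, hF⟩ := exists_fg_subcoalgebra (k := k) x
  -- Generators of a finite-dimensional subcoalgebra containing `x`, together with their antipodes:
  -- since `S ∘ S = 1` the set is stable under `S`, and by `comul_antipode` the comultiplication of
  -- the added elements stays in the tensor square.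
  let g : Set H := s ∪ HopfAlgebra.antipode k '' s
  let S : Subalgebra k H := Algebra.adjoin k g
  have hFS : F ≤ Subalgebra.toSubmodule S := by
    rw [← hs, Submodule.span_le]
    exact fun y hy => Algebra.subset_adjoin (Or.inl hy)
  have hS' : S ≤ S.comap (HopfAlgebra.antipodeAlgHom k H) := by
    refine Algebra.adjoin_le ?_
    rintro y (hy | ⟨z, hz, rfl⟩)
    · exact Algebra.subset_adjoin (Or.inr ⟨y, hy, rfl⟩)
    · have h : HopfAlgebra.antipode k (HopfAlgebra.antipode k z) ∈ S :=
        (antipode_antipode (k := k) z).symm ▸ Algebra.subset_adjoin (Or.inl hz)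
      exact h
  have hsF {y : H} (hy : y ∈ s) : y ∈ F := hs ▸ Submodule.subset_span hy
  have hS : S ≤ (Algebra.TensorProduct.map S.val S.val).range.comap
      (Bialgebra.comulAlgHom k H) := by
    refine Algebra.adjoin_le ?_
    rintro y (hy | ⟨z, hz, rfl⟩)
    · obtain ⟨t, ht⟩ := hF y (hsF hy)
      change Coalgebra.comul (R := k) y ∈ (Algebra.TensorProduct.map S.val S.val).range
      rw [← ht]
      clear ht
      induction t with
      | zero => rw [map_zero]; exact zero_mem _
      | tmul a b => exact tmul_mem_range (hFS a.2) (hFS b.2)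
      | add a b ha hb => rw [map_add]; exact add_mem ha hb
    · obtain ⟨t, ht⟩ := hF z (hsF hz)
      change Coalgebra.comul (R := k) (HopfAlgebra.antipode k z) ∈
        (Algebra.TensorProduct.map S.val S.val).range
      rw [comul_antipode, ← ht]
      clear ht
      induction t with
      | zero => rw [map_zero, map_zero]; exact zero_mem _
      | tmul a b =>
        rw [TensorProduct.map_tmul, antipodeSwap_tmul]
        exact tmul_mem_range (hS' (hFS b.2)) (hS' (hFS a.2))
      | add a b ha hb => rw [map_add, map_add]; exact add_mem ha hb
  exact ⟨S, ⟨Subalgebra.fg_def.2 ⟨g, s.finite_toSet.union (s.finite_toSet.image _), rfl⟩,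
    fun y hy => hS hy, fun y hy => hS' hy⟩, hFS hx⟩

end Hopf

section Presentation

/-- The directed set of finitely generated Hopf subalgebras. -/
abbrev FGHopfSubalgebra (H : CommHopfAlgCat.{u} k) : Type u :=
  {S : Subalgebra k H // IsFGHopfSubalgebra S}

variable (H : CommHopfAlgCat.{u} k)

instance : Nonempty (FGHopfSubalgebra H) :=
  let ⟨S, hS, _⟩ := exists_isFGHopfSubalgebra (k := k) (0 : H)
  ⟨⟨S, hS⟩⟩

instance : IsDirectedOrder (FGHopfSubalgebra H) :=
  ⟨fun S T => ⟨⟨S.1 ⊔ T.1, S.2.sup T.2⟩, (le_sup_left : S.1 ≤ S.1 ⊔ T.1),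
    (le_sup_right : T.1 ≤ S.1 ⊔ T.1)⟩⟩

noncomputable instance (S : FGHopfSubalgebra H) : HopfAlgebra k S.1 :=
  subHopfAlgebra S.1 S.2.comul_mem S.2.antipode_mem

/-- The inclusion of a Hopf subalgebra. -/
noncomputable def FGHopfSubalgebra.incl (S : FGHopfSubalgebra H) : S.1 →ₐc[k] H :=
  BialgHom.ofAlgHom S.1.val rfl (AlgHom.ext fun x => map_subComul S.1 S.2.comul_mem x)

/-- The inclusion of a Hopf subalgebra in a larger one. -/
noncomputable def FGHopfSubalgebra.inclusion {S T : FGHopfSubalgebra H} (h : S ≤ T) :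
    S.1 →ₐc[k] T.1 :=
  BialgHom.ofAlgHom (Subalgebra.inclusion h) rfl (AlgHom.ext fun x => by
    apply map_val_injective T.1 T.1
    refine Eq.trans ?_ (map_subComul T.1 T.2.comul_mem (Subalgebra.inclusion h x)).symm
    refine Eq.trans ?_ (map_subComul S.1 S.2.comul_mem x)
    have e : (Algebra.TensorProduct.map T.1.val T.1.val).comp
        (Algebra.TensorProduct.map (Subalgebra.inclusion h) (Subalgebra.inclusion h)) =
        Algebra.TensorProduct.map S.1.val S.1.val := by
      apply Algebra.TensorProduct.ext'
      intro a b
      rfl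
    exact DFunLike.congr_fun e _)

/-- The diagram of finitely generated Hopf subalgebras. -/
noncomputable def fgHopfDiagram : FGHopfSubalgebra H ⥤ FGCommHopfAlgCat k where
  obj S := ⟨CommHopfAlgCat.of k S.1, (Subalgebra.fg_iff_finiteType S.1).1 S.2.fg⟩
  map f := ObjectProperty.homMk (CommHopfAlgCat.ofHom (FGHopfSubalgebra.inclusion H f.le))

/-- The cocone of inclusions of finitely generated Hopf subalgebras. -/
noncomputable def fgHopfCocone : Cocone (fgHopfDiagram H ⋙ ObjectProperty.ι
    (fun H : CommHopfAlgCat.{u} k => Algebra.FiniteType k H)) where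
  pt := H
  ι.app S := CommHopfAlgCat.ofHom (FGHopfSubalgebra.incl H S)

/-- An element of an algebra is a homomorphism from `k[X]`, which is finitely presentable and so
factors through a stage. -/
theorem exists_leg_eq {J : Type u} [SmallCategory J] [IsFiltered J] {A : J ⥤ CommHopfAlgCat.{u} k}
    {c : Cocone (A ⋙ forgetToAlg k)} (hc : IsColimit c) (r : c.pt) :
    ∃ (j : J) (x : A.obj j), leg c j x = r := by
  have := isFinitelyPresentable_commAlgCat (k := k) (Polynomial k)
  obtain ⟨j, g, hg⟩ := IsFinitelyPresentable.exists_hom_of_isColimit hc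
    (X := CommAlgCat.of k (Polynomial k)) (CommAlgCat.ofHom (Y := c.pt) (Polynomial.aeval r))
  refine ⟨j, g.hom Polynomial.X, (ConcreteCategory.congr_hom hg Polynomial.X).trans ?_⟩
  exact Polynomial.aeval_X r

/-- Injectivity holds because every element of the colimit comes from a stage, and the stages embed
in `H`; surjectivity is local finiteness. -/
theorem bijective_algDesc_fgHopfCocone {c : Cocone ((fgHopfDiagram H ⋙ ObjectProperty.ι
    (fun H : CommHopfAlgCat.{u} k => Algebra.FiniteType k H)) ⋙ forgetToAlg k)}
    (hc : IsColimit c) : Function.Bijective (algDesc hc (fgHopfCocone H)) := by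
  constructor
  · refine (injective_iff_map_eq_zero _).2 fun r hr => ?_
    obtain ⟨S, x, rfl⟩ := exists_leg_eq hc r
    have h : hopfLeg (fgHopfCocone H) S x = 0 := (algDesc_leg hc _ S x).symm.trans hr
    have hx : x = 0 := Subtype.ext h
    rw [hx, map_zero]
  · intro (y : H)
    obtain ⟨S, hS, hy⟩ := exists_isFGHopfSubalgebra (k := k) y
    exact ⟨leg c ⟨S, hS⟩ (⟨y, hy⟩ : S), algDesc_leg hc (fgHopfCocone H) ⟨S, hS⟩ (⟨y, hy⟩ : S)⟩

end Presentation

end LocalFiniteness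

/-- Commutative Hopf algebras are the Ind-completion of the finitely generated ones. -/
theorem nonempty_indPresentation_commHopfAlgCat (k : Type u) [Field k] :
    Nonempty (IndPresentation
      (ObjectProperty.ι (fun H : CommHopfAlgCat.{u} k => Algebra.FiniteType k H))) := by
  refine nonempty_indPresentation _ (fun J _ _ K =>
    ⟨hopfCocone (colimit.isColimit ((K ⋙ ObjectProperty.ι _) ⋙ forgetToAlg k)),
      ⟨isColimitHopfCocone _⟩, isCompactCocone_hopfCocone _⟩) (fun H => ?_)
  let K := fgHopfDiagram H ⋙ ObjectProperty.ι
    (fun H : CommHopfAlgCat.{u} k => Algebra.FiniteType k H)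
  let hc := colimit.isColimit (K ⋙ forgetToAlg k)
  let d := (isColimitHopfCocone hc).desc (fgHopfCocone H)
  have : IsIso ((forget (CommHopfAlgCat.{u} k)).map d) :=
    (isIso_iff_bijective _).2 (bijective_algDesc_fgHopfCocone H hc)
  have hd : IsIso d := isIso_of_reflects_iso d (forget (CommHopfAlgCat.{u} k))
  exact ⟨FGHopfSubalgebra H, inferInstance, inferInstance, fgHopfDiagram H, hopfCocone hc,
    ⟨isColimitHopfCocone hc⟩, ⟨@asIso _ _ (hopfCocone hc).pt H d hd⟩⟩

end HopfPi0

/-! ### Transport to given Ind-completions, and the main theorem -/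

theorem HopfPi0.indExtend_full_faithful {C C' D D' : Type w} [Category.{v} C] [Category.{v} C']
    [Category.{v} D] [Category.{v} D'] {ι : C ⥤ C'} {κ : D ⥤ D'} (P : HopfPi0.IndPresentation ι)
    (Q : HopfPi0.IndPresentation κ) (F : C ⥤ D) [(HopfPi0.indMap F).Full]
    [(HopfPi0.indMap F).Faithful] :
    (HopfPi0.indExtend P Q F).Full ∧ (HopfPi0.indExtend P Q F).Faithful :=
  ⟨inferInstanceAs (P.equiv.inverse ⋙ HopfPi0.indMap F ⋙ Q.equiv.functor).Full,
    inferInstanceAs (P.equiv.inverse ⋙ HopfPi0.indMap F ⋙ Q.equiv.functor).Faithful⟩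

/-- The adjunction between the Ind-extended functors, read on given Ind-completions. -/
noncomputable def HopfPi0.indExtendAdjunction {C C' D D' : Type w} [Category.{v} C]
    [Category.{v} C'] [Category.{v} D] [Category.{v} D'] {ι : C ⥤ C'} {κ : D ⥤ D'}
    (P : HopfPi0.IndPresentation ι) (Q : HopfPi0.IndPresentation κ) {F : C ⥤ D} {G : D ⥤ C}
    (adj : F ⊣ G) : HopfPi0.indExtend P Q F ⊣ HopfPi0.indExtend Q P G :=
  P.equiv.symm.toAdjunction.comp ((HopfPi0.indAdjunction adj).comp Q.equiv.toAdjunction)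

theorem mainTheorem3 {k : Type u} [Field k] [IsSepClosed k] :
    -- `π₀(A)` is the maximal separable subalgebra of a finitely generated algebra `A`
    (∀ (A : Type u) [CommRing A] [Algebra k A] [Algebra.FiniteType k A],
      IsGreatest {B : Subalgebra k A | HopfPi0.IsFiniteSeparable k B} (HopfPi0.pi0 k A)) ∧
    -- the coreflection of the opposite of finite groups in f.g. commutative Hopf algebras
    (HopfPi0.constHopf k).Full ∧ (HopfPi0.constHopf k).Faithful ∧
    ∃ adj : HopfPi0.constHopf k ⊣ HopfPi0.pi0Points k,
      -- it extends to an adjunction between the Ind-extended functors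
      (∃ adjInd : HopfPi0.indMap (HopfPi0.constHopf k) ⊣ HopfPi0.indMap (HopfPi0.pi0Points k),
        ∀ G : FiniteGrp.{u}ᵒᵖ,
          adjInd.unit.app (Ind.yoneda.obj G) =
            Ind.yoneda.map (adj.unit.app G) ≫
              (HopfPi0.indMapUnit (HopfPi0.pi0Points k)).app ((HopfPi0.constHopf k).obj G) ≫
              (HopfPi0.indMap (HopfPi0.pi0Points k)).map
                ((HopfPi0.indMapUnit (HopfPi0.constHopf k)).app G)) ∧
      -- Stone groups and commutative Hopf algebras are the Ind-completions, and on them the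
      -- Ind-extended functors form a coreflection
      Nonempty (HopfPi0.IndPresentation (forget₂ FiniteGrp.{u} ProfiniteGrp.{u}).op) ∧
      Nonempty (HopfPi0.IndPresentation
        (ObjectProperty.ι (fun H : CommHopfAlgCat.{u} k => Algebra.FiniteType k H))) ∧
      ∀ (P : HopfPi0.IndPresentation (forget₂ FiniteGrp.{u} ProfiniteGrp.{u}).op)
        (Q : HopfPi0.IndPresentation
          (ObjectProperty.ι (fun H : CommHopfAlgCat.{u} k => Algebra.FiniteType k H))),
        (HopfPi0.indExtend P Q (HopfPi0.constHopf k)).Full ∧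
        (HopfPi0.indExtend P Q (HopfPi0.constHopf k)).Faithful ∧
        Nonempty (HopfPi0.indExtend P Q (HopfPi0.constHopf k) ⊣
          HopfPi0.indExtend Q P (HopfPi0.pi0Points k)) := by
  obtain ⟨hfull, hfaithful⟩ := HopfPi0.indMap_full_faithful (HopfPi0.constPointsAdjunction k)
  exact ⟨fun A _ _ _ => ⟨HopfPi0.isFiniteSeparable_pi0 k A, fun B hB => le_sSup hB⟩,
    (HopfPi0.constPointsAdjunction k).fullyFaithfulLOfIsIsoUnit.full,
    (HopfPi0.constPointsAdjunction k).fullyFaithfulLOfIsIsoUnit.faithful,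
    HopfPi0.constPointsAdjunction k,
    ⟨HopfPi0.indAdjunction (HopfPi0.constPointsAdjunction k), fun G =>
      HopfPi0.indUnit_app_yoneda (HopfPi0.constPointsAdjunction k) G⟩,
    HopfPi0.nonempty_indPresentation_profiniteGrp,
    HopfPi0.nonempty_indPresentation_commHopfAlgCat k,
    fun P Q => ⟨(HopfPi0.indExtend_full_faithful P Q _).1,
      (HopfPi0.indExtend_full_faithful P Q _).2,
      ⟨HopfPi0.indExtendAdjunction P Q (HopfPi0.constPointsAdjunction k)⟩⟩⟩
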